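/- Let $d\ge 1$ and let $K\subset\mathbb{R}^d$ be a nonempty compact connected set with Lipschitz boundary, i.e. near each point of $\partial K$, in suitable orthonormal coordinates, $K$ is the set of points on or above the graph of a Lipschitz function. For $j\in\mathbb{N}$ let $E^j=(2^{-j}\mathbb{Z}^d\setminus K)\cup\{a^*_j\}$, where $a_j^*$ is one additional point. Let $G^j$ be the simple graph on $E^j$ in which * $x,y\in 2^{-j}\mathbb{Z}^d\setminus K$ are adjacent iff $|x-y|=2^{-j}$ and the segment $[x,y]$ does not meet $K$; * $x\in 2^{-j}\mathbb{Z}^d\setminus K$ and $a^*_j$ are adjacent iff there is $y\in 2^{-j}\mathbb{Z}^d$ with $|x-y|=2^{-j}$ such that $[x,y]$ meets $K$. Let $v_j(x)$ be the degree of $x$ in $G^j$, let $m_j$ be the measure on $E^j$ with $m_j(\{x\})=\frac{2^{-jd}}{2d}v_j(x)$, and let $\mathcal{E}^j$ be the Dirichlet form on $L^2(E^j,m_j)$, with domain $L^2(E^j,m_j)$, $$\mathcal{E}^j(f,f)=\frac{2^{-(d-2)j}}{4d}\sum_{(x,y):\,x\leftrightarrow y\text{ in }G^j}(f(x)-f(y))^2,$$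 where the sum is over ordered pairs of adjacent vertices. Let $(P^j_t)_{t\ge0}$ be the semigroup on $L^2(E^j,m_j)$ associated with $\mathcal{E}^j$, i.e. the transition semigroup of the symmetric Markov process $X^j$ associated with $\mathcal{E}^j$. Then there is an integer $N_1\ge1$ with the following properties. 1. (Isoperimetric inequality.) There is $C_2>0$ such that for all $j\ge N_1$ and all finite nonempty $A\subset E^j$, $$\frac{2^{-jd}}{2d}\,\#\{(x,y): x\in A,\ y\in E^j\setminus A,\ x\leftrightarrow y\}\ \ge\ C_2\,2^{-j}\,m_j(A)^{(d-1)/d}.$$ 2. (Uniform Nash inequality.) There is $c>0$ such that for all $j\ge N_1$ and all $f\in L^1(m_j)\cap L^2(m_j)$, $$c\,\|f\|_{L^2(m_j)}^{2+4/d}\ \le\ \mathcal{E}^j(f,f)\,\|f\|_{L^1(m_j)}^{4/d}.$$ 3. (Heat kernel bound.) There is $C>0$ such that for all $j\ge N_1$, $$\|P^j_t\|_{1\to\infty}\le \frac{C}{t^{d/2}}\qquad\text{for all }t>0,$$ where $\|\cdot\|_{1\to\infty}$ is the operator norm from $L^1(m_j)$ to $L^\infty(m_j)$. The constants $N_1$,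 $C_2$, $c$, $C$ may depend on $d$ and $K$ but not on $j$. -/

import Mathlib

open MeasureTheory Set
open scoped ENNReal NNReal RealInnerProductSpace

noncomputable section

namespace DarnedWalk

/-- `K` has Lipschitz boundary: near every boundary point, in suitable orthonormal coordinates
(with `e` the direction of the last coordinate), `K` is the set of points on or above the graph of
a Lipschitz function of the remaining coordinates `x - ⟪e, x⟫ e`. -/
def HasLipschitzBoundary {d : ℕ} (K : Set (EuclideanSpace ℝ (Fin d))) : Prop :=
  ∀ p ∈ frontier K, ∃ (e : EuclideanSpace ℝ (Fin d)) (r : ℝ) (L : ℝ≥0)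
    (γ : EuclideanSpace ℝ (Fin d) → ℝ), ‖e‖ = 1 ∧ 0 < r ∧ LipschitzWith L γ ∧
      ∀ x ∈ Metric.ball p r, x ∈ K ↔ γ (x - ⟪e, x⟫ • e) ≤ ⟪e, x⟫

/-- The mesh size `2^{-j}`. -/
def mesh (j : ℕ) : ℝ := (1 / 2) ^ j

/-- The point `2^{-j} z` of the lattice `2^{-j} ℤ^d`. -/
def latticePoint {d : ℕ} (j : ℕ) (z : Fin d → ℤ) : EuclideanSpace ℝ (Fin d) :=
  WithLp.toLp 2 fun i => mesh j * z i

/-- The state space `E^j = (2^{-j} ℤ^d \ K) ∪ {a*_j}`: the lattice points outside `K`, each given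
by its integer coordinates, and one further point `star`, which is `a*_j`. -/
inductive State {d : ℕ} (K : Set (EuclideanSpace ℝ (Fin d))) (j : ℕ) : Type
  | pt (z : Fin d → ℤ) (hz : latticePoint j z ∉ K) : State K j
  | star : State K j

/-- `z` and `w` are the endpoints of an edge of `2^{-j} ℤ^d`. -/
def LatticeAdj {d : ℕ} (j : ℕ) (z w : Fin d → ℤ) : Prop :=
  dist (latticePoint j z) (latticePoint j w) = mesh j

/-- The edge of `2^{-j} ℤ^d` from `z` to `w`, as a closed line segment, intersects `K`. -/
def EdgeMeets {d : ℕ} (K : Set (EuclideanSpace ℝ (Fin d))) (j : ℕ) (z w : Fin d → ℤ) : Prop :=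
  (segment ℝ (latticePoint j z) (latticePoint j w) ∩ K).Nonempty

variable {d : ℕ} (K : Set (EuclideanSpace ℝ (Fin d))) (j : ℕ)

/-- Adjacency in the graph `G^j`. -/
def StateAdj : State K j → State K j → Prop
  | .pt z _, .pt w _ => LatticeAdj j z w ∧ ¬ EdgeMeets K j z w
  | .pt z _, .star => ∃ w, LatticeAdj j z w ∧ EdgeMeets K j z w
  | .star, .pt z _ => ∃ w, LatticeAdj j z w ∧ EdgeMeets K j z w
  | .star, .star => False

/-- The graph `G^j` on `E^j`. -/
def graph : SimpleGraph (State K j) where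
  Adj := StateAdj K j
  symm := ⟨by
    rintro (⟨z, hz⟩ | _) (⟨w, hw⟩ | _) h
    · simp only [StateAdj, LatticeAdj, EdgeMeets] at h ⊢
      rwa [dist_comm, segment_symm]
    all_goals exact h⟩
  loopless := ⟨by
    rintro (⟨z, hz⟩ | _) h
    · have h1 := h.1
      simp only [LatticeAdj, dist_self, mesh] at h1
      exact absurd h1 (by positivity)
    · exact h⟩

instance : MeasurableSpace (State K j) := ⊤

instance : MeasurableSingletonClass (State K j) := ⟨fun _ => trivial⟩

/-- The weight `2^{-jd} / (2d)` of every edge of `G^j`. -/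
def edgeWeight (d j : ℕ) : ℝ := mesh j ^ d / (2 * d)

/-- The degree `v_j(x)`, the number of vertices adjacent to `x` in `G^j`. -/
def degree (x : State K j) : ℝ≥0∞ := (((graph K j).neighborSet x).encard : ℝ≥0∞)

/-- The measure `m_j` on `E^j`, with `m_j({x}) = 2^{-jd} / (2d) * v_j(x)`. -/
def speedMeasure : Measure (State K j) :=
  Measure.sum fun x => (ENNReal.ofReal (edgeWeight d j) * degree K j x) • Measure.dirac x

/-- The weight `μ_{E^j}(A, E^j \ A)` of the edges of `G^j` between `A` and its complement. -/
def boundaryWeight (A : Set (State K j)) : ℝ≥0∞ :=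
  ENNReal.ofReal (edgeWeight d j) *
    ({e : (graph K j).Dart | e.fst ∈ A ∧ e.snd ∉ A}.encard : ℝ≥0∞)

/-- The (real) Hilbert space `L²(E^j, m_j)`. -/
abbrev L2 : Type := Lp ℝ 2 (speedMeasure K j)

/-- The Dirichlet form `𝓔^j`, in its polarized form. The sum is over all oriented edges of `G^j`,
so each edge counts twice; it converges absolutely for all `f` and `g` in `L²(E^j, m_j)`. -/
def dirichletForm (f g : State K j → ℝ) : ℝ :=
  mesh j ^ ((d : ℤ) - 2) / (4 * d) *
    ∑' e : (graph K j).Dart, (f e.fst - f e.snd) * (g e.fst - g e.snd)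

theorem edgeWeight_pos [NeZero d] : 0 < edgeWeight d j := by
  have : (0 : ℝ) < d := by exact_mod_cast Nat.pos_of_ne_zero (NeZero.ne d)
  unfold edgeWeight mesh
  positivity

theorem lintegral_speedMeasure (F : State K j → ℝ≥0∞) :
    ∫⁻ x, F x ∂(speedMeasure K j) =
      ENNReal.ofReal (edgeWeight d j) * ∑' e : (graph K j).Dart, F e.fst := by
  let φ : (Σ x : State K j, (graph K j).neighborSet x) ≃ (graph K j).Dart :=
    { toFun := fun p => ⟨(p.1, p.2.1), p.2.2⟩
      invFun := fun e => ⟨e.fst, e.snd, e.adj⟩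
      left_inv := fun _ => rfl
      right_inv := fun _ => rfl }
  rw [speedMeasure, lintegral_sum_measure, ← φ.tsum_eq, ENNReal.tsum_sigma', ← ENNReal.tsum_mul_left]
  congr 1
  ext x
  rw [lintegral_smul_measure, lintegral_dirac]
  change _ = _ * ∑' _ : (graph K j).neighborSet x, F x
  rw [ENNReal.tsum_const, smul_eq_mul, mul_assoc]
  rfl

theorem eq_of_ae_eq [NeZero d] {f g : State K j → ℝ} (h : f =ᵐ[speedMeasure K j] g)
    {x y : State K j} (hxy : (graph K j).Adj x y) : f x = g x := by
  by_contra hne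
  have h0 : speedMeasure K j {x} = 0 := measure_mono_null (by simpa using hne) h
  have h1 := lintegral_speedMeasure K j (({x} : Set (State K j)).indicator 1)
  rw [lintegral_indicator_one (measurableSet_singleton x), h0] at h1
  have h2 : (1 : ℝ≥0∞) ≤ ∑' e : (graph K j).Dart, ({x} : Set (State K j)).indicator 1 e.fst := by
    refine le_trans ?_ (ENNReal.le_tsum ⟨(x, y), hxy⟩)
    simp
  have h3 : ENNReal.ofReal (edgeWeight d j) ≠ 0 := by simpa using edgeWeight_pos (d := d) j
  rcases mul_eq_zero.1 h1.symm with h4 | h4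
  · exact h3 h4
  · rw [h4] at h2
    simp at h2

theorem tsum_dart_sq [NeZero d] (f : L2 K j) :
    Summable (fun e : (graph K j).Dart => f e.fst ^ 2) ∧
      edgeWeight d j * ∑' e : (graph K j).Dart, f e.fst ^ 2 = ‖f‖ ^ 2 := by
  have hw := edgeWeight_pos (d := d) j
  have h1 := lintegral_speedMeasure K j fun x => ENNReal.ofReal (f x ^ 2)
  have hint : Integrable (fun x => f x ^ 2) (speedMeasure K j) := (Lp.memLp f).integrable_sq
  have h2 : ENNReal.ofReal (‖f‖ ^ 2) = ∫⁻ x, ENNReal.ofReal (f x ^ 2) ∂(speedMeasure K j) := by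
    rw [← ofReal_integral_eq_lintegral_ofReal hint (ae_of_all _ fun x => sq_nonneg _),
      ← real_inner_self_eq_norm_sq, L2.inner_def]
    congr 2
    ext x
    simp [sq]
  rw [← h2] at h1
  have h3 : ∑' e : (graph K j).Dart, ENNReal.ofReal (f e.fst ^ 2) ≠ ∞ := by
    intro h
    rw [h, ENNReal.mul_top (by simpa using hw)] at h1
    exact ENNReal.ofReal_ne_top h1
  have h4 : Summable (fun e : (graph K j).Dart => f e.fst ^ 2) := by
    have := ENNReal.summable_toReal h3
    simpa only [ENNReal.toReal_ofReal (sq_nonneg _)] using this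
  refine ⟨h4, ?_⟩
  rw [← ENNReal.ofReal_tsum_of_nonneg (fun _ => sq_nonneg _) h4, ← ENNReal.ofReal_mul hw.le] at h1
  exact ((ENNReal.ofReal_eq_ofReal_iff (by positivity)
    (mul_nonneg hw.le (tsum_nonneg fun _ => sq_nonneg _))).1 h1).symm

theorem tsum_dart_sub_sq [NeZero d] (f : L2 K j) :
    Summable (fun e : (graph K j).Dart => (f e.fst - f e.snd) ^ 2) ∧
      ∑' e : (graph K j).Dart, (f e.fst - f e.snd) ^ 2 ≤ 4 / edgeWeight d j * ‖f‖ ^ 2 := by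
  have hw := edgeWeight_pos (d := d) j
  obtain ⟨h1, h2⟩ := tsum_dart_sq K j f
  let φ : (graph K j).Dart ≃ (graph K j).Dart :=
    Function.Involutive.toPerm _ SimpleGraph.Dart.symm_involutive
  have h3 : Summable (fun e : (graph K j).Dart => f e.snd ^ 2) := (φ.summable_iff).2 h1
  have h4 : ∑' e : (graph K j).Dart, f e.snd ^ 2 = ∑' e : (graph K j).Dart, f e.fst ^ 2 :=
    φ.tsum_eq fun e => f e.fst ^ 2
  have hle : ∀ e : (graph K j).Dart,
      (f e.fst - f e.snd) ^ 2 ≤ 2 * f e.fst ^ 2 + 2 * f e.snd ^ 2 := fun e => by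
    nlinarith [sq_nonneg (f e.fst + f e.snd)]
  have h5 := (h1.mul_left 2).add (h3.mul_left 2)
  have h6 := Summable.of_nonneg_of_le (fun e => sq_nonneg _) hle h5
  refine ⟨h6, (h6.tsum_le_tsum hle h5).trans (le_of_eq ?_)⟩
  rw [(h1.mul_left 2).tsum_add (h3.mul_left 2), tsum_mul_left, tsum_mul_left, h4, ← h2]
  field_simp
  ring

/-- The discrete gradient `f ↦ (f(x) - f(y))`, indexed by the oriented edges, as a linear map. -/
def gradient [NeZero d] : L2 K j →ₗ[ℝ] lp (fun _ : (graph K j).Dart => ℝ) 2 where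
  toFun f := ⟨fun e => f e.fst - f e.snd, memℓp_gen (by
    simpa using (tsum_dart_sub_sq K j f).1)⟩
  map_add' f g := by
    ext e
    have h := Lp.coeFn_add f g
    have h1 := eq_of_ae_eq K j h e.adj
    have h2 := eq_of_ae_eq K j h e.adj.symm
    simp only [Pi.add_apply] at h1 h2
    change (f + g) e.fst - (f + g) e.snd = (f e.fst - f e.snd) + (g e.fst - g e.snd)
    rw [h1, h2]
    ring
  map_smul' c f := by
    ext e
    have h := Lp.coeFn_smul c f
    have h1 := eq_of_ae_eq K j h e.adj
    have h2 := eq_of_ae_eq K j h e.adj.symm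
    simp only [Pi.smul_apply, smul_eq_mul] at h1 h2
    change (c • f) e.fst - (c • f) e.snd = c * (f e.fst - f e.snd)
    rw [h1, h2]
    ring

theorem norm_gradient_le [NeZero d] (f : L2 K j) :
    ‖gradient K j f‖ ≤ √(4 / edgeWeight d j) * ‖f‖ := by
  have hw := edgeWeight_pos (d := d) j
  refine lp.norm_le_of_tsum_le (by simp) (by positivity) ?_
  have h := (tsum_dart_sub_sq K j f).2
  have h1 : (√(4 / edgeWeight d j) * ‖f‖) ^ 2 = 4 / edgeWeight d j * ‖f‖ ^ 2 := by
    rw [mul_pow, Real.sq_sqrt (by positivity)]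
  rw [← h1] at h
  simp only [ENNReal.toReal_ofNat, Real.rpow_ofNat, Real.norm_eq_abs, sq_abs]
  exact h

/-- The form `𝓔^j` on `L²(E^j, m_j)` is represented by exactly one bounded operator. -/
theorem existsUnique_generator [NeZero d] : ∃! A : L2 K j →L[ℝ] L2 K j,
    ∀ f g : L2 K j, ⟪A f, g⟫ = -dirichletForm K j f g := by
  let T := (gradient K j).mkContinuous _ (norm_gradient_le K j)
  refine ⟨-((mesh j ^ ((d : ℤ) - 2) / (4 * d)) • ((ContinuousLinearMap.adjoint T).comp T)), ?_, ?_⟩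
  · intro f g
    simp only [neg_apply, smul_apply, ContinuousLinearMap.comp_apply, inner_neg_left,
      real_inner_smul_left, ContinuousLinearMap.adjoint_inner_left, lp.inner_eq_tsum,
      dirichletForm]
    congr 2
    refine tsum_congr fun e => ?_
    exact mul_comm _ _
  · intro B hB
    ext1 f
    refine ext_inner_right ℝ fun g => ?_
    rw [hB]
    simp only [neg_apply, smul_apply, ContinuousLinearMap.comp_apply, inner_neg_left,
      real_inner_smul_left, ContinuousLinearMap.adjoint_inner_left, lp.inner_eq_tsum,
      dirichletForm]
    congr 2
    refine tsum_congr fun e => ?_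
    exact mul_comm _ _

/-- The generator of `(𝓔^j, L²(E^j, m_j))`: the operator `A` with `⟪A f, g⟫ = -𝓔^j(f, g)`. -/
def generator [NeZero d] : L2 K j →L[ℝ] L2 K j :=
  (existsUnique_generator K j).choose

/-- The semigroup `P^j_t = exp (t A)` on `L²(E^j, m_j)` associated with the Dirichlet form `𝓔^j`,
that is, the transition semigroup of the symmetric Markov process `X^j` associated with it. -/
def semigroup [NeZero d] (t : ℝ) : L2 K j →L[ℝ] L2 K j :=
  NormedSpace.exp (t • generator K j)

/-- `‖T‖_{1 → ∞}`: the norm of `T` as an operator from `L¹(m_j)` to `L^∞(m_j)`, tested on the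
dense subspace `L¹ ∩ L²` of `L¹`. -/
def normOneInfty {d : ℕ} {K : Set (EuclideanSpace ℝ (Fin d))} {j : ℕ}
    (T : L2 K j →L[ℝ] L2 K j) : ℝ≥0∞ :=
  ⨆ (f : L2 K j) (_ : eLpNorm f 1 (speedMeasure K j) ≤ 1), eLpNorm (T f) ∞ (speedMeasure K j)

end DarnedWalk

end

noncomputable section

namespace DarnedWalk

/-! Isoperimetry implies Nash, and Nash implies heat kernel decay. Constants stay uniform in `j`
because the powers of the mesh cancel at each stage.

Isoperimetry: a finite subset of ℤ^d must be left along every axis-parallel line through it, so a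
Loomis–Whitney inequality (`encard_rpow_le_encard_of_lines`) bounds its size by its inner or outer
vertex boundary. If `A` omits `star`, this is applied to the lattice points of `A`; if `A` contains
`star`, the lattice points of `K` are added first. The one vertex of unbounded degree is `star`, of
degree O(2^{jd}). The Lipschitz boundary gives `K` nonempty interior, so for large `j` the added
points number at least c·2^{jd}, and the size of the filled set controls the mass of `star`.

Nash (`nash_of_isoperimetric`): write ‖f‖₂² as the integral over `s` of the masses of {f² > s}. Low
levels are controlled by ‖f‖₁. On high levels Markov's inequality makes the mass small, so
isoperimetry bounds it by a small multiple of the boundary weight. The coarea inequality and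
Cauchy–Schwarz bound the integrated boundary weights by the Dirichlet form.

Heat kernel (`normOneInfty_semigroup_le`): the semigroup contracts L¹, so Nash becomes a
differential inequality for ‖P_t f‖₂², giving the L¹ → L² bound. Self-adjointness and P_t = P_{t/2}
P_{t/2} turn this into L¹ → L^∞. -/

/-! ### Discrete isoperimetry on ℤ^d -/

theorem pi_count_eq_count (ι : Type*) [Fintype ι] :
    Measure.pi (fun _ : ι => (Measure.count : Measure ℤ)) = Measure.count := by
  refine Measure.ext_of_singleton fun x => ?_
  rw [Measure.pi_singleton, Measure.count_singleton]
  simp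

/-- A Loomis–Whitney inequality: a set that meets every axis-parallel line through a point of `A`
has at least `#A ^ ((d - 1) / d)` elements. -/
theorem encard_rpow_le_encard_of_lines {d : ℕ} [NeZero d] {A S : Set (Fin d → ℤ)}
    (hA : A.Nonempty) (h : ∀ x ∈ A, ∀ i, ∃ k, Function.update x i k ∈ S) :
    (A.encard : ℝ≥0∞) ^ (((d : ℝ) - 1) / d) ≤ (S.encard : ℝ≥0∞) := by
  have hd : 1 ≤ d := Nat.one_le_iff_ne_zero.2 (NeZero.ne d)
  rcases hd.eq_or_lt with rfl | hd
  · obtain ⟨x, hx⟩ := hA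
    obtain ⟨k, hk⟩ := h x hx 0
    have h1 : (1 : ℕ∞) ≤ S.encard := one_le_encard_iff_nonempty.2 ⟨_, hk⟩
    have h2 : (1 : ℝ≥0∞) ≤ (S.encard : ℝ≥0∞) := by exact_mod_cast h1
    simpa using h2
  have hd1 : (0 : ℝ) < (d : ℝ) - 1 := by
    have : (1 : ℝ) < d := by exact_mod_cast hd
    linarith
  have hd0 : (0 : ℝ) < d := by linarith
  -- For p = 1/(d-1) the pointwise factor has exponent 1 - (d-1)p = 0, hence equals 1 even off `S`.
  -- Only the line sums of the indicator of `S` remain, and at points of `A` each is at least 1.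
  have key := lintegral_mul_prod_lintegral_pow_le (fun _ : Fin d => (Measure.count : Measure ℤ))
    (p := 1 / ((d : ℝ) - 1)) (by positivity)
    (by rw [Fintype.card_fin, mul_one_div_cancel hd1.ne'])
    (f := S.indicator 1) (measurable_of_countable _)
  rw [pi_count_eq_count, lintegral_indicator_one (Set.to_countable S).measurableSet,
    Measure.count_apply (Set.to_countable S).measurableSet] at key
  have h1 : (A.encard : ℝ≥0∞) ≤ (S.encard : ℝ≥0∞) ^ (1 + 1 / ((d : ℝ) - 1)) := by
    refine le_trans ?_ key
    rw [← Measure.count_apply (Set.to_countable A).measurableSet,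
      ← lintegral_indicator_one (Set.to_countable A).measurableSet]
    refine lintegral_mono fun x => ?_
    by_cases hx : x ∈ A
    · rw [indicator_of_mem hx, Fintype.card_fin, mul_one_div_cancel hd1.ne', sub_self,
        ENNReal.rpow_zero, one_mul, Pi.one_apply]
      refine Finset.one_le_prod' fun i _ => ?_
      refine ENNReal.one_le_rpow ?_ (by positivity)
      obtain ⟨k, hk⟩ := h x hx i
      rw [lintegral_count]
      refine le_trans ?_ (ENNReal.le_tsum k)
      rw [indicator_of_mem hk, Pi.one_apply]
    · rw [indicator_of_notMem hx]
      exact zero_le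
  calc (A.encard : ℝ≥0∞) ^ (((d : ℝ) - 1) / d)
      ≤ ((S.encard : ℝ≥0∞) ^ (1 + 1 / ((d : ℝ) - 1))) ^ (((d : ℝ) - 1) / d) :=
        ENNReal.rpow_le_rpow h1 (by positivity)
    _ = (S.encard : ℝ≥0∞) := by
        rw [← ENNReal.rpow_mul]
        have : (1 + 1 / ((d : ℝ) - 1)) * (((d : ℝ) - 1) / d) = 1 := by field_simp; ring
        rw [this, ENNReal.rpow_one]

theorem exists_int_lt_mem_notMem {p : ℤ → Prop} {k : ℤ} (hk : p k)
    (hfin : {n | p n}.Finite) : ∃ n, p n ∧ ¬ p (n + 1) := by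
  by_contra! hcon
  have h : ∀ n : ℕ, p (k + n) := by
    intro n
    induction n with
    | zero => simpa using hk
    | succ n ih => simpa [add_assoc] using hcon _ ih
  refine hfin.not_infinite (Set.infinite_of_injective_forall_mem (f := fun n : ℕ => k + n) ?_ h)
  intro a b hab
  simpa using hab

variable {d : ℕ} {K : Set (EuclideanSpace ℝ (Fin d))} {j : ℕ}

theorem mesh_pos (j : ℕ) : 0 < mesh j := by unfold mesh; positivity

theorem dist_latticePoint_update (z : Fin d → ℤ) (i : Fin d) (k l : ℤ) :
    dist (latticePoint j (Function.update z i k)) (latticePoint j (Function.update z i l)) =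
      mesh j * |(k : ℝ) - l| := by
  have h : latticePoint j (Function.update z i k) - latticePoint j (Function.update z i l) =
      EuclideanSpace.single i (mesh j * ((k : ℝ) - l)) := by
    ext m
    by_cases hm : m = i
    · subst hm
      simp [latticePoint]
      ring
    · simp [latticePoint, hm]
  rw [dist_eq_norm, h, PiLp.norm_single, Real.norm_eq_abs, abs_mul,
    abs_of_pos (mesh_pos j)]

theorem latticeAdj_update_succ (z : Fin d → ℤ) (i : Fin d) (k : ℤ) :
    LatticeAdj j (Function.update z i k) (Function.update z i (k + 1)) := by
  rw [LatticeAdj, dist_latticePoint_update]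
  simp

theorem LatticeAdj.symm {z w : Fin d → ℤ} (h : LatticeAdj j z w) : LatticeAdj j w z := by
  rwa [LatticeAdj, dist_comm]

theorem EdgeMeets.symm {z w : Fin d → ℤ}
    (h : EdgeMeets K j z w) : EdgeMeets K j w z := by
  rwa [EdgeMeets, segment_symm]

theorem LatticeAdj.abs_sub_le {z w : Fin d → ℤ} (h : LatticeAdj j z w) (i : Fin d) :
    |w i - z i| ≤ 1 := by
  have h1 := PiLp.norm_apply_le (latticePoint j w - latticePoint j z) i
  rw [← dist_eq_norm, dist_comm, h] at h1
  have h2 : (latticePoint j w - latticePoint j z) i = mesh j * ((w i : ℝ) - z i) := by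
    simp [latticePoint]
    ring
  rw [h2, Real.norm_eq_abs, abs_mul, abs_of_pos (mesh_pos j)] at h1
  have h3 : |(w i : ℝ) - z i| ≤ 1 := by
    have := mesh_pos j
    by_contra! hcon
    nlinarith
  exact_mod_cast h3

/-- Edge-isoperimetric inequality on the lattice, in terms of the inner vertex boundary. -/
theorem encard_rpow_le_innerBoundary [NeZero d] {A : Set (Fin d → ℤ)} (hA : A.Nonempty)
    (hfin : A.Finite) :
    (A.encard : ℝ≥0∞) ^ (((d : ℝ) - 1) / d) ≤
      ({z | z ∈ A ∧ ∃ w, w ∉ A ∧ LatticeAdj j z w}.encard : ℝ≥0∞) := by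
  refine encard_rpow_le_encard_of_lines hA fun x hx i => ?_
  obtain ⟨n, hn, hn'⟩ := exists_int_lt_mem_notMem (p := fun k => Function.update x i k ∈ A)
    (k := x i) (by simpa) (hfin.preimage (Function.update_injective x i).injOn)
  exact ⟨n, hn, _, hn', latticeAdj_update_succ x i n⟩

/-- Edge-isoperimetric inequality on the lattice, in terms of the outer vertex boundary. -/
theorem encard_rpow_le_outerBoundary [NeZero d] {A : Set (Fin d → ℤ)} (hA : A.Nonempty)
    (hfin : A.Finite) :
    (A.encard : ℝ≥0∞) ^ (((d : ℝ) - 1) / d) ≤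
      ({w | w ∉ A ∧ ∃ z ∈ A, LatticeAdj j z w}.encard : ℝ≥0∞) := by
  refine encard_rpow_le_encard_of_lines hA fun x hx i => ?_
  obtain ⟨n, hn, hn'⟩ := exists_int_lt_mem_notMem (p := fun k => Function.update x i k ∈ A)
    (k := x i) (by simpa) (hfin.preimage (Function.update_injective x i).injOn)
  exact ⟨n + 1, hn', _, hn, latticeAdj_update_succ x i n⟩

/-! ### Degrees and lattice point counts -/

/-- The integer coordinates of a state, `none` for the point `a*_j`. -/
def State.coords : State K j → Option (Fin d → ℤ)
  | .pt z _ => some z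
  | .star => none

theorem State.coords_injective : Function.Injective (State.coords (K := K) (j := j)) := by
  rintro (⟨z, hz⟩ | _) (⟨w, hw⟩ | _) h <;> simp_all [State.coords]

instance : Countable (State K j) := State.coords_injective.countable

instance : Countable (graph K j).Dart :=
  Function.Injective.countable (f := fun e : (graph K j).Dart => e.toProd)
    (SimpleGraph.Dart.toProd_injective)

theorem encard_Icc_pi (a b : Fin d → ℤ) :
    (Icc a b).encard = ((∏ i, (b i + 1 - a i).toNat : ℕ) : ℕ∞) := by
  rw [← Finset.coe_Icc, Set.encard_coe_eq_coe_finsetCard, Pi.card_Icc]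
  simp

theorem encard_le_of_coords {A : Set (State K j)} {B : Set (Fin d → ℤ)}
    (h : ∀ x ∈ A, ∀ z ∈ x.coords, z ∈ B) : A.encard ≤ B.encard + 1 := by
  rw [← State.coords_injective.encard_image]
  calc (State.coords '' A).encard ≤ (insert none (some '' B)).encard := by
        refine encard_le_encard ?_
        rintro _ ⟨x, hx, rfl⟩
        cases hc : x.coords with
        | none => exact mem_insert _ _
        | some z => exact mem_insert_of_mem _ ⟨z, h x hx z hc, rfl⟩
    _ ≤ (some '' B).encard + 1 := encard_insert_le _ _
    _ = B.encard + 1 := by rw [(Option.some_injective _).encard_image]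

/-- Lattice neighbours differ by at most 1 in each coordinate; the extra 1 allows for `star`. -/
theorem degree_pt_le (z : Fin d → ℤ) (hz : latticePoint j z ∉ K) :
    degree K j (.pt z hz) ≤ 3 ^ d + 1 := by
  have h : ((graph K j).neighborSet (.pt z hz)).encard ≤ (Icc (z - 1) (z + 1)).encard + 1 := by
    refine encard_le_of_coords ?_
    rintro (⟨w, hw⟩ | _) hx y hy
    · obtain rfl : w = y := by simpa [State.coords] using hy
      have h1 : LatticeAdj j z w := And.left hx
      constructor <;> intro i <;> have := abs_le.1 (h1.abs_sub_le i) <;>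
        simp only [Pi.sub_apply, Pi.add_apply, Pi.one_apply] <;> linarith
    · simp [State.coords] at hy
  rw [encard_Icc_pi] at h
  have h3 : ∀ i, ((z + 1) i + 1 - (z - 1) i).toNat = 3 := fun i => by
    simp only [Pi.sub_apply, Pi.add_apply, Pi.one_apply]
    omega
  simp only [h3, Finset.prod_const, Finset.card_univ, Fintype.card_fin] at h
  rw [degree]
  exact_mod_cast h

theorem one_le_degree_pt [NeZero d] (z : Fin d → ℤ) (hz : latticePoint j z ∉ K) :
    1 ≤ degree K j (.pt z hz) := by
  have h : ((graph K j).neighborSet (.pt z hz)).Nonempty := by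
    set w := Function.update z 0 (z 0 + 1) with hw
    have hadj : LatticeAdj j z w := by
      have := latticeAdj_update_succ (j := j) z 0 (z 0)
      rwa [Function.update_eq_self] at this
    by_cases hm : EdgeMeets K j z w
    · exact ⟨.star, w, hadj, hm⟩
    · have hwK : latticePoint j w ∉ K := fun h => hm ⟨_, right_mem_segment _ _ _, h⟩
      exact ⟨.pt w hwK, hadj, hm⟩
  have h1 : 1 ≤ ((graph K j).neighborSet (.pt z hz)).encard := one_le_encard_iff_nonempty.2 h
  rw [degree]
  exact_mod_cast h1

theorem mesh_le_one (j : ℕ) : mesh j ≤ 1 := pow_le_one₀ (by norm_num) (by norm_num)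

/-- A nonempty compact set is not clopen here, so it has a frontier point. Moving from that point by
r/2 along `e` makes the graph inequality strict, which is an open condition. -/
theorem HasLipschitzBoundary.interior_nonempty [NeZero d] (hK : HasLipschitzBoundary K)
    (hc : IsCompact K) (hne : K.Nonempty) : (interior K).Nonempty := by
  have hf : (frontier K).Nonempty := by
    by_contra! h
    rcases isClopen_iff.1 (isClopen_iff_frontier_eq_empty.2 h) with h1 | h1
    · exact hne.ne_empty h1
    · exact noncompact_univ _ (h1 ▸ hc)
  obtain ⟨p, hp⟩ := hf
  obtain ⟨e, r, L, γ, he, hr, hγ, h⟩ := hK p hp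
  have hpK := (h p (Metric.mem_ball_self hr)).1 (hc.isClosed.frontier_subset hp)
  let F : EuclideanSpace ℝ (Fin d) → ℝ := fun x => ⟪e, x⟫ - γ (x - ⟪e, x⟫ • e)
  have hF : Continuous F := by
    have := hγ.continuous
    fun_prop
  refine ⟨p + (r / 2) • e, mem_interior.2 ⟨Metric.ball p r ∩ F ⁻¹' Ioi 0, ?_,
    Metric.isOpen_ball.inter (isOpen_Ioi.preimage hF), ?_, ?_⟩⟩
  · rintro x ⟨hx1, hx2⟩
    refine (h x hx1).2 ?_
    have : 0 < F x := hx2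
    simp only [F] at this
    linarith
  · rw [Metric.mem_ball, dist_eq_norm, add_sub_cancel_left, norm_smul, he, Real.norm_eq_abs,
      abs_of_pos (by positivity)]
    linarith
  · have h1 : ⟪e, p + (r / 2) • e⟫ = ⟪e, p⟫ + r / 2 := by
      rw [inner_add_right, inner_smul_right, real_inner_self_eq_norm_sq, he]
      ring
    have h2 : p + (r / 2) • e - (⟪e, p⟫ + r / 2) • e = p - ⟪e, p⟫ • e := by module
    simp only [F, mem_preimage, mem_Ioi, h1, h2]
    linarith

/-- A neighbour of `star` lies within one mesh, hence within distance 1, of `K`. So all neighbours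
lie in one ball independent of `j`. -/
theorem degree_star_le (hK : Bornology.IsBounded K) :
    ∃ C : ℝ, 0 < C ∧ ∀ j, degree K j .star ≤ ENNReal.ofReal (C * (2 ^ j) ^ d) := by
  obtain ⟨R, hR0, hR⟩ := hK.subset_closedBall_lt 0 0
  refine ⟨(2 * (R + 1) + 2) ^ d, by positivity, fun j => ?_⟩
  set N := ⌊(R + 1) * 2 ^ j⌋₊ with hN
  have hmesh : mesh j * 2 ^ j = 1 := by
    rw [mesh, ← mul_pow]
    norm_num
  have h : ((graph K j).neighborSet .star).encard ≤
      (Icc (fun _ : Fin d => -(N : ℤ)) (fun _ => (N : ℤ))).encard := by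
    rw [← State.coords_injective.encard_image,
      ← (Option.some_injective (Fin d → ℤ)).encard_image (Icc _ _)]
    refine encard_le_encard ?_
    rintro _ ⟨x, hx, rfl⟩
    rcases x with ⟨z, hz⟩ | _
    · obtain ⟨w, hadj, y, hy, hyK⟩ : ∃ w, LatticeAdj j z w ∧ EdgeMeets K j z w := hx
      refine ⟨z, ?_, rfl⟩
      have h1 : dist (latticePoint j z) y ≤ 1 := by
        have h2 : y ∈ Metric.closedBall (latticePoint j z) (mesh j) := by
          refine (convex_closedBall _ _).segment_subset (Metric.mem_closedBall_self (mesh_pos j).le)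
            ?_ hy
          rw [Metric.mem_closedBall, dist_comm]
          exact hadj.le
        rw [dist_comm]
        exact (Metric.mem_closedBall.1 h2).trans (mesh_le_one j)
      have h2 : ‖latticePoint j z‖ ≤ R + 1 := by
        have h3 := hR hyK
        rw [Metric.mem_closedBall] at h3
        have := dist_triangle (latticePoint j z) y 0
        rw [← dist_zero_right]
        linarith
      have h3 : ∀ i, |z i| ≤ (N : ℤ) := fun i => by
        have h4 := (PiLp.norm_apply_le (latticePoint j z) i).trans h2
        have h5 : (latticePoint j z) i = mesh j * (z i : ℝ) := rfl
        rw [h5, Real.norm_eq_abs, abs_mul, abs_of_pos (mesh_pos j)] at h4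
        have h6 : |(z i : ℝ)| ≤ (R + 1) * 2 ^ j := by
          calc |(z i : ℝ)| = (mesh j * |(z i : ℝ)|) * 2 ^ j := by
                rw [mul_right_comm, hmesh, one_mul]
            _ ≤ _ := by gcongr
        rw [Int.abs_eq_natAbs, hN]
        refine Int.ofNat_le.2 (Nat.le_floor ?_)
        rwa [Nat.cast_natAbs, Int.cast_abs]
      exact ⟨fun i => (abs_le.1 (h3 i)).1, fun i => (abs_le.1 (h3 i)).2⟩
    · exact False.elim hx
  rw [encard_Icc_pi] at h
  have h3 : ((N : ℤ) + 1 - -(N : ℤ)).toNat = 2 * N + 1 := by omega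
  simp only [h3, Finset.prod_const, Finset.card_univ, Fintype.card_fin] at h
  calc degree K j .star ≤ (((2 * N + 1) ^ d : ℕ) : ℝ≥0∞) := by
        rw [degree]
        exact_mod_cast h
    _ = ENNReal.ofReal (((2 * N + 1 : ℕ) : ℝ) ^ d) := by
        rw [← ENNReal.ofReal_natCast, Nat.cast_pow]
    _ ≤ _ := by
        refine ENNReal.ofReal_le_ofReal ?_
        rw [← mul_pow]
        refine pow_le_pow_left₀ (by positivity) ?_ d
        have h4 : (N : ℝ) ≤ (R + 1) * 2 ^ j := Nat.floor_le (by positivity)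
        have h5 : (1 : ℝ) ≤ 2 ^ j := one_le_pow₀ (by norm_num)
        push_cast
        nlinarith

/-- Once the mesh is small, a sup-norm ball inside `K` contains a lattice box with at least a fixed
multiple of 2^j points per side. -/
theorem exists_le_encard_latticePoint_mem (hK : (interior K).Nonempty) :
    ∃ (c : ℝ) (N : ℕ), 0 < c ∧ 1 ≤ N ∧ ∀ j, N ≤ j →
      ENNReal.ofReal (c * (2 ^ j) ^ d) ≤ ({z | latticePoint j z ∈ K}.encard : ℝ≥0∞) := by
  obtain ⟨p, hp⟩ := hK
  have hcont : ContinuousAt (fun q : Fin d → ℝ => (WithLp.toLp 2 q : EuclideanSpace ℝ (Fin d)))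
      (WithLp.ofLp p) := (PiLp.continuous_toLp 2 _).continuousAt
  have hev := hcont.preimage_mem_nhds (t := K) (mem_interior_iff_mem_nhds.1 hp)
  obtain ⟨ρ, hρ, hball⟩ := Metric.mem_nhds_iff.1 hev
  obtain ⟨N, hN⟩ := exists_pow_lt_of_lt_one (show 0 < ρ / 4 by positivity)
    (show (1 / 2 : ℝ) < 1 by norm_num)
  refine ⟨(ρ / 4) ^ d, N + 1, by positivity, by omega, fun j hj => ?_⟩
  have hm : mesh j < ρ / 4 := by
    refine lt_of_le_of_lt ?_ hN
    exact pow_le_pow_of_le_one (by norm_num) (by norm_num) (by omega)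
  have hmesh : mesh j * 2 ^ j = 1 := by
    rw [mesh, ← mul_pow]
    norm_num
  -- The box starts at the rounded-down coordinates of `p`. Rounding costs one mesh, less than ρ/4,
  -- and the sides have length at most ρ/4, so the box stays within ρ/2 of `p`.
  set n := ⌊ρ / 4 * 2 ^ j⌋₊ with hn
  set b : Fin d → ℤ := fun i => ⌊p i * 2 ^ j⌋ with hb
  have hsub : Icc b (fun i => b i + n) ⊆ {z | latticePoint j z ∈ K} := by
    intro z hz
    refine hball (?_ : (fun i => mesh j * (z i : ℝ)) ∈ Metric.ball (WithLp.ofLp p) ρ)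
    rw [Metric.mem_ball]
    refine lt_of_le_of_lt ((dist_pi_le_iff (r := ρ / 2) (by positivity)).2 fun i => ?_)
      (by linarith)
    have hp0 := mesh_pos j
    have h1 : (b i : ℝ) ≤ z i := by exact_mod_cast hz.1 i
    have h2 : (z i : ℝ) ≤ b i + n := by exact_mod_cast hz.2 i
    have h3 : (b i : ℝ) ≤ p i * 2 ^ j := Int.floor_le _
    have h4 : p i * 2 ^ j < b i + 1 := Int.lt_floor_add_one _
    have h5 : (n : ℝ) ≤ ρ / 4 * 2 ^ j := Nat.floor_le (by positivity)
    have h6 : mesh j * (z i : ℝ) - p i = mesh j * (z i - p i * 2 ^ j) := by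
      rw [mul_sub, mul_left_comm, hmesh, mul_one]
    rw [Real.dist_eq, h6, abs_mul, abs_of_pos hp0]
    have h7 : |(z i : ℝ) - p i * 2 ^ j| ≤ 1 + ρ / 4 * 2 ^ j := by
      rw [abs_le]
      have : 0 ≤ ρ / 4 * 2 ^ j := by positivity
      constructor <;> linarith
    calc mesh j * |(z i : ℝ) - p i * 2 ^ j| ≤ mesh j * (1 + ρ / 4 * 2 ^ j) := by gcongr
      _ = mesh j + ρ / 4 * (mesh j * 2 ^ j) := by ring
      _ ≤ ρ / 2 := by rw [hmesh]; linarith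
  have h := encard_le_encard hsub
  rw [encard_Icc_pi] at h
  have h3 : ∀ i, (b i + (n : ℤ) + 1 - b i).toNat = n + 1 := fun i => by omega
  simp only [h3, Finset.prod_const, Finset.card_univ, Fintype.card_fin] at h
  calc ENNReal.ofReal ((ρ / 4) ^ d * (2 ^ j) ^ d) ≤ ENNReal.ofReal (((n + 1 : ℕ) : ℝ) ^ d) := by
        refine ENNReal.ofReal_le_ofReal ?_
        rw [← mul_pow]
        refine pow_le_pow_left₀ (by positivity) ?_ d
        push_cast
        exact (Nat.lt_floor_add_one _).le
    _ = (((n + 1) ^ d : ℕ) : ℝ≥0∞) := by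
        rw [← ENNReal.ofReal_natCast, Nat.cast_pow]
    _ ≤ _ := by exact_mod_cast h

theorem finite_latticePoint_mem (hK : Bornology.IsBounded K) :
    {z | latticePoint j z ∈ K}.Finite := by
  obtain ⟨R, hR0, hR⟩ := hK.subset_closedBall_lt 0 0
  set N := ⌈R / mesh j⌉ with hN
  refine (Set.finite_Icc (fun _ : Fin d => -N) (fun _ => N)).subset fun z hz => ?_
  have h3 : ∀ i, |z i| ≤ N := fun i => by
    have h2 := hR hz
    rw [Metric.mem_closedBall, dist_zero_right] at h2
    have h4 := (PiLp.norm_apply_le (latticePoint j z) i).trans h2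
    have h5 : (latticePoint j z) i = mesh j * (z i : ℝ) := rfl
    rw [h5, Real.norm_eq_abs, abs_mul, abs_of_pos (mesh_pos j), mul_comm,
      ← le_div_iff₀ (mesh_pos j)] at h4
    have h6 := h4.trans (Int.le_ceil _)
    exact_mod_cast h6
  exact ⟨fun i => (abs_le.1 (h3 i)).1, fun i => (abs_le.1 (h3 i)).2⟩

/-! ### Isoperimetric inequality on the darned graph -/

theorem speedMeasure_apply (A : Set (State K j)) :
    speedMeasure K j A =
      ∑' x, ENNReal.ofReal (edgeWeight d j) * degree K j x * A.indicator 1 x := by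
  have hA : MeasurableSet A := trivial
  rw [speedMeasure, Measure.sum_apply _ hA]
  refine tsum_congr fun x => ?_
  rw [Measure.smul_apply, Measure.dirac_apply' _ hA, smul_eq_mul]

theorem speedMeasure_singleton (x : State K j) :
    speedMeasure K j {x} = ENNReal.ofReal (edgeWeight d j) * degree K j x := by
  rw [speedMeasure_apply, tsum_eq_single x]
  · simp
  · intro y hy
    simp [hy]

theorem speedMeasure_le_of_degree_le {A : Set (State K j)} {D : ℝ≥0∞}
    (h : ∀ x ∈ A, degree K j x ≤ D) :
    speedMeasure K j A ≤ ENNReal.ofReal (edgeWeight d j) * D * (A.encard : ℝ≥0∞) := by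
  have h1 : (A.encard : ℝ≥0∞) = ∑' x, A.indicator (1 : State K j → ℝ≥0∞) x := by
    rw [← Measure.count_apply (s := A) trivial, ← lintegral_indicator_one (s := A) trivial,
      lintegral_count]
  rw [speedMeasure_apply, h1, ← ENNReal.tsum_mul_left]
  refine ENNReal.tsum_le_tsum fun x => ?_
  by_cases hx : x ∈ A
  · gcongr
    exact h x hx
  · simp [hx]

/-- The lattice points in `A`. -/
def latticePart (A : Set (State K j)) : Set (Fin d → ℤ) := {z | ∃ hz, State.pt z hz ∈ A}

theorem encard_diff_star (A : Set (State K j)) :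
    (A \ {State.star}).encard = (latticePart A).encard := by
  rw [← State.coords_injective.encard_image, ← (Option.some_injective (Fin d → ℤ)).encard_image]
  congr 1
  ext o
  constructor
  · rintro ⟨⟨z, hz⟩ | _, ⟨hx, hx'⟩, rfl⟩
    · exact ⟨z, ⟨hz, hx⟩, rfl⟩
    · exact absurd rfl hx'
  · rintro ⟨z, ⟨hz, hx⟩, rfl⟩
    exact ⟨_, ⟨hx, by simp⟩, rfl⟩

theorem finite_latticePart {A : Set (State K j)} (hA : A.Finite) : (latticePart A).Finite := by
  rw [← encard_lt_top_iff, ← encard_diff_star]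
  exact encard_lt_top_iff.2 hA.sdiff

theorem speedMeasure_diff_star_le (A : Set (State K j)) :
    speedMeasure K j (A \ {State.star}) ≤
      ENNReal.ofReal (edgeWeight d j) * (3 ^ d + 1) * ((latticePart A).encard : ℝ≥0∞) := by
  rw [← encard_diff_star]
  refine speedMeasure_le_of_degree_le ?_
  rintro (⟨z, hz⟩ | _) ⟨hx, hx'⟩
  · exact degree_pt_le z hz
  · exact absurd rfl hx'

/-- Boundary edges are counted by their endpoint in `A`: outer endpoints lying in or behind `K`
would all collapse to `star`. -/
theorem encard_rpow_le_encard_dart_of_star_notMem [NeZero d] {A : Set (State K j)}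
    (hA : A.Finite) (hne : A.Nonempty) (hs : State.star ∉ A) :
    ((latticePart A).encard : ℝ≥0∞) ^ (((d : ℝ) - 1) / d) ≤
      ({e : (graph K j).Dart | e.fst ∈ A ∧ e.snd ∉ A}.encard : ℝ≥0∞) := by
  have hne' : (latticePart A).Nonempty := by
    obtain ⟨⟨z, hz⟩ | _, hx⟩ := hne
    · exact ⟨z, hz, hx⟩
    · exact absurd hx hs
  refine (encard_rpow_le_innerBoundary (j := j) hne' (finite_latticePart hA)).trans ?_
  refine ENat.toENNReal_mono ?_
  rw [← (Option.some_injective (Fin d → ℤ)).encard_image]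
  refine le_trans (encard_le_encard ?_)
    (encard_image_le (fun e : (graph K j).Dart => e.fst.coords) _)
  rintro _ ⟨z, ⟨⟨hz, hzA⟩, w, hw, hadj⟩, rfl⟩
  by_cases hm : EdgeMeets K j z w
  · exact ⟨⟨(.pt z hz, .star), w, hadj, hm⟩, ⟨hzA, hs⟩, rfl⟩
  · have hwK : latticePoint j w ∉ K := fun h => hm ⟨_, right_mem_segment _ _ _, h⟩
    exact ⟨⟨(.pt z hz, .pt w hwK), hadj, hm⟩, ⟨hzA, fun h => hw ⟨hwK, h⟩⟩, rfl⟩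

/-- Boundary edges are counted by their endpoint outside `A`, which is always a genuine lattice
vertex. An edge of the filled set that meets `K` is replaced by one starting at `star`; any other
starts at a lattice point of `A`. -/
theorem encard_rpow_le_encard_dart_of_star_mem [NeZero d] {A : Set (State K j)}
    (hK : Bornology.IsBounded K) (hA : A.Finite) (hs : State.star ∈ A)
    (hne : (latticePart A ∪ {z | latticePoint j z ∈ K}).Nonempty) :
    ((latticePart A ∪ {z | latticePoint j z ∈ K}).encard : ℝ≥0∞) ^ (((d : ℝ) - 1) / d) ≤
      ({e : (graph K j).Dart | e.fst ∈ A ∧ e.snd ∉ A}.encard : ℝ≥0∞) := by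
  refine (encard_rpow_le_outerBoundary (j := j) hne
    ((finite_latticePart hA).union (finite_latticePoint_mem hK))).trans ?_
  refine ENat.toENNReal_mono ?_
  rw [← (Option.some_injective (Fin d → ℤ)).encard_image]
  refine le_trans (encard_le_encard ?_)
    (encard_image_le (fun e : (graph K j).Dart => e.snd.coords) _)
  rintro _ ⟨w, ⟨hw, z, hz, hadj⟩, rfl⟩
  have hwK : latticePoint j w ∉ K := fun h => hw (Or.inr h)
  have hwA : State.pt w hwK ∉ A := fun h => hw (Or.inl ⟨hwK, h⟩)
  by_cases hm : EdgeMeets K j z w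
  · exact ⟨⟨(.star, .pt w hwK), z, hadj.symm, hm.symm⟩, ⟨hs, hwA⟩, rfl⟩
  · have hzK : latticePoint j z ∉ K := fun h => hm ⟨_, left_mem_segment _ _ _, h⟩
    rcases hz with ⟨hz, hzA⟩ | hz
    · exact ⟨⟨(.pt z hz, .pt w hwK), hadj, hm⟩, ⟨hzA, hwA⟩, rfl⟩
    · exact absurd hz hzK

/-- Passes from cardinalities to weights. The identity (h^d)^{(d-1)/d} · h = h^d, with h the mesh,
removes all dependence of the constant on `j`. -/
theorem ofReal_mul_rpow_le_of_le [NeZero d] {D : ℝ} (hD : 0 < D) {m b s : ℝ≥0∞}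
    (hm : m ≤ ENNReal.ofReal (edgeWeight d j) * ENNReal.ofReal D * b)
    (hb : b ^ (((d : ℝ) - 1) / d) ≤ s) :
    ENNReal.ofReal ((2 * d * (D / (2 * d)) ^ (((d : ℝ) - 1) / d))⁻¹ * mesh j) *
        m ^ (((d : ℝ) - 1) / d) ≤ ENNReal.ofReal (edgeWeight d j) * s := by
  have hd1 : (1 : ℝ) ≤ d := by exact_mod_cast Nat.one_le_iff_ne_zero.2 (NeZero.ne d)
  set θ : ℝ := ((d : ℝ) - 1) / d with hθ
  have hθ0 : 0 ≤ θ := div_nonneg (by linarith) (by linarith)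
  have hw := edgeWeight_pos (d := d) j
  have hh := mesh_pos j
  have h1 : m ^ θ ≤ ENNReal.ofReal ((edgeWeight d j * D) ^ θ) * s := by
    calc m ^ θ ≤ (ENNReal.ofReal (edgeWeight d j) * ENNReal.ofReal D * b) ^ θ :=
          ENNReal.rpow_le_rpow hm hθ0
      _ = ENNReal.ofReal ((edgeWeight d j * D) ^ θ) * b ^ θ := by
          rw [ENNReal.mul_rpow_of_nonneg _ _ hθ0, ← ENNReal.ofReal_mul hw.le,
            ENNReal.ofReal_rpow_of_nonneg (by positivity) hθ0]
      _ ≤ _ := by gcongr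
  refine (mul_le_mul_right h1 _).trans (le_of_eq ?_)
  rw [← mul_assoc, ← ENNReal.ofReal_mul (by positivity)]
  congr 2
  have h2 : edgeWeight d j * D = mesh j ^ d * (D / (2 * d)) := by
    rw [edgeWeight]
    ring
  have h3 : (mesh j ^ d) ^ θ * mesh j = mesh j ^ d := by
    rw [← Real.rpow_natCast, ← Real.rpow_mul hh.le]
    nth_rewrite 2 [← Real.rpow_one (mesh j)]
    rw [← Real.rpow_add hh]
    congr 1
    rw [hθ]
    field_simp
    ring
  have h4 : 0 < (D / (2 * d)) ^ θ := by positivity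
  rw [h2, Real.mul_rpow (by positivity) (by positivity), edgeWeight, eq_div_iff (by positivity)]
  calc _ = (mesh j ^ d) ^ θ * mesh j := by field_simp
    _ = _ := h3

theorem isoperimetric [NeZero d] (hb : Bornology.IsBounded K) (hi : (interior K).Nonempty) :
    ∃ N : ℕ, 1 ≤ N ∧ ∃ C : ℝ, 0 < C ∧ ∀ j : ℕ, N ≤ j → ∀ A : Set (State K j), A.Finite →
      A.Nonempty → ENNReal.ofReal (C * mesh j) * speedMeasure K j A ^ (((d : ℝ) - 1) / d) ≤
        boundaryWeight K j A := by
  obtain ⟨C, hC, hstar⟩ := degree_star_le hb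
  obtain ⟨c, N, hc, hN, hcard⟩ := exists_le_encard_latticePoint_mem hi
  have hd0 : (0 : ℝ) < d := by exact_mod_cast Nat.pos_of_ne_zero (NeZero.ne d)
  -- 3^d + 1 bounds the degree of a lattice vertex; C/c bounds the degree of `star` per point of the
  -- filled set.
  have hD : 0 < 3 ^ d + 1 + C / c := by positivity
  refine ⟨N, hN, (2 * d * ((3 ^ d + 1 + C / c) / (2 * d)) ^ (((d : ℝ) - 1) / d))⁻¹,
    by positivity, fun j hj A hA hne => ?_⟩
  have h3 : ENNReal.ofReal (3 ^ d + 1 + C / c) = 3 ^ d + 1 + ENNReal.ofReal (C / c) := by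
    rw [ENNReal.ofReal_add (by positivity) (by positivity),
      ENNReal.ofReal_add (by positivity) (by positivity), ENNReal.ofReal_pow (by positivity)]
    simp
  have hdiff := speedMeasure_diff_star_le A
  by_cases hs : State.star ∈ A
  · set B := latticePart A ∪ {z | latticePoint j z ∈ K} with hB
    have hKB : ({z | latticePoint j z ∈ K}.encard : ℝ≥0∞) ≤ (B.encard : ℝ≥0∞) :=
      ENat.toENNReal_mono (encard_le_encard subset_union_right)
    have hAB : ((latticePart A).encard : ℝ≥0∞) ≤ (B.encard : ℝ≥0∞) :=
      ENat.toENNReal_mono (encard_le_encard subset_union_left)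
    have hdeg : degree K j .star ≤ ENNReal.ofReal (C / c) * (B.encard : ℝ≥0∞) := by
      calc degree K j .star ≤ ENNReal.ofReal (C * (2 ^ j) ^ d) := hstar j
        _ = ENNReal.ofReal (C / c) * ENNReal.ofReal (c * (2 ^ j) ^ d) := by
            rw [← ENNReal.ofReal_mul (by positivity)]
            congr 1
            field_simp
        _ ≤ _ := by
            gcongr
            exact (hcard j hj).trans hKB
    have hneB : B.Nonempty := by
      rw [nonempty_iff_ne_empty]
      intro h
      rw [h, encard_empty] at hKB
      have := (hcard j hj).trans hKB
      simp only [ENat.toENNReal_zero, nonpos_iff_eq_zero, ENNReal.ofReal_eq_zero] at this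
      have : 0 < c * (2 ^ j) ^ d := by positivity
      linarith
    refine ofReal_mul_rpow_le_of_le hD (b := (B.encard : ℝ≥0∞)) ?_
      (encard_rpow_le_encard_dart_of_star_mem hb hA hs hneB)
    calc speedMeasure K j A ≤ speedMeasure K j (A \ {.star}) + speedMeasure K j {.star} := by
          refine (measure_mono ?_).trans (measure_union_le _ _)
          intro x hx
          by_cases h : x = .star
          · exact Or.inr h
          · exact Or.inl ⟨hx, h⟩
      _ ≤ ENNReal.ofReal (edgeWeight d j) * (3 ^ d + 1) * (B.encard : ℝ≥0∞) +
          ENNReal.ofReal (edgeWeight d j) * (ENNReal.ofReal (C / c) * (B.encard : ℝ≥0∞)) := by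
          rw [speedMeasure_singleton]
          exact add_le_add (hdiff.trans (by gcongr)) (by gcongr)
      _ = _ := by rw [h3]; ring
  · refine ofReal_mul_rpow_le_of_le hD (b := ((latticePart A).encard : ℝ≥0∞)) ?_
      (encard_rpow_le_encard_dart_of_star_notMem hA hne hs)
    rw [sdiff_singleton_eq_self hs] at hdiff
    refine hdiff.trans ?_
    rw [h3]
    exact mul_le_mul' (mul_le_mul' le_rfl le_self_add) le_rfl

/-! ### From isoperimetry to the Nash inequality -/

theorem dirichletForm_eq (f g : State K j → ℝ) :
    dirichletForm K j f g = edgeWeight d j / (2 * mesh j ^ 2) *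
      ∑' e : (graph K j).Dart, (f e.fst - f e.snd) * (g e.fst - g e.snd) := by
  have hh := mesh_pos j
  rw [dirichletForm, edgeWeight, zpow_sub₀ hh.ne', zpow_natCast]
  congr 1
  rw [zpow_ofNat, div_div, div_div]
  congr 1
  ring

theorem dirichletForm_self_eq (f : State K j → ℝ) :
    dirichletForm K j f f = edgeWeight d j / (2 * mesh j ^ 2) *
      ∑' e : (graph K j).Dart, (f e.fst - f e.snd) ^ 2 := by
  simp only [dirichletForm_eq, sq]

theorem dirichletForm_self_nonneg [NeZero d] (f : State K j → ℝ) :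
    0 ≤ dirichletForm K j f f := by
  have hw := edgeWeight_pos (d := d) j
  have hh := mesh_pos j
  rw [dirichletForm_self_eq]
  exact mul_nonneg (by positivity) (tsum_nonneg fun _ => sq_nonneg _)

theorem tsum_dart_snd_sq [NeZero d] (f : L2 K j) :
    Summable (fun e : (graph K j).Dart => f e.snd ^ 2) ∧
      edgeWeight d j * ∑' e : (graph K j).Dart, f e.snd ^ 2 = ‖f‖ ^ 2 := by
  obtain ⟨h1, h2⟩ := tsum_dart_sq K j f
  let φ : (graph K j).Dart ≃ (graph K j).Dart :=
    Function.Involutive.toPerm _ SimpleGraph.Dart.symm_involutive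
  exact ⟨(φ.summable_iff).2 h1, (congrArg (edgeWeight d j * ·)
    (φ.tsum_eq fun e => f e.fst ^ 2)).trans h2⟩

theorem abs_sq_sub_sq_eq (a b : ℝ) : |a ^ 2 - b ^ 2| = |a - b| * |a + b| := by
  rw [← abs_mul]
  congr 1
  ring

/-- The discrete gradient of `f ^ 2` in `L¹`, by the Cauchy–Schwarz inequality. -/
theorem tsum_dart_abs_sq_sub_sq_le [NeZero d] (f : L2 K j) :
    Summable (fun e : (graph K j).Dart => |f e.fst ^ 2 - f e.snd ^ 2|) ∧
      edgeWeight d j * ∑' e : (graph K j).Dart, |f e.fst ^ 2 - f e.snd ^ 2| ≤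
        √8 * mesh j * √(dirichletForm K j f f * ‖f‖ ^ 2) := by
  have hw := edgeWeight_pos (d := d) j
  have hh := mesh_pos j
  obtain ⟨h1, -⟩ := tsum_dart_sub_sq K j f
  obtain ⟨h2, h2'⟩ := tsum_dart_sq K j f
  obtain ⟨h3, h3'⟩ := tsum_dart_snd_sq f
  have hle : ∀ e : (graph K j).Dart,
      (f e.fst + f e.snd) ^ 2 ≤ 2 * f e.fst ^ 2 + 2 * f e.snd ^ 2 := fun e => by
    nlinarith [sq_nonneg (f e.fst - f e.snd)]
  have h5 := (h2.mul_left 2).add (h3.mul_left 2)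
  have h6 := Summable.of_nonneg_of_le (fun e => sq_nonneg _) hle h5
  have h7 : edgeWeight d j * ∑' e : (graph K j).Dart, (f e.fst + f e.snd) ^ 2 ≤ 4 * ‖f‖ ^ 2 := by
    calc _ ≤ edgeWeight d j * ∑' e : (graph K j).Dart, (2 * f e.fst ^ 2 + 2 * f e.snd ^ 2) := by
          exact mul_le_mul_of_nonneg_left (h6.tsum_le_tsum hle h5) hw.le
      _ = 2 * (edgeWeight d j * ∑' e : (graph K j).Dart, f e.fst ^ 2) +
          2 * (edgeWeight d j * ∑' e : (graph K j).Dart, f e.snd ^ 2) := by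
          rw [(h2.mul_left 2).tsum_add (h3.mul_left 2), tsum_mul_left, tsum_mul_left]
          ring
      _ = _ := by rw [h2', h3']; ring
  have hcs := Real.summable_and_inner_le_Lp_mul_Lq_tsum_of_nonneg Real.HolderConjugate.two_two
    (f := fun e : (graph K j).Dart => |f e.fst - f e.snd|)
    (g := fun e : (graph K j).Dart => |f e.fst + f e.snd|)
    (fun _ => abs_nonneg _) (fun _ => abs_nonneg _) (by simpa using h1) (by simpa using h6)
  simp only [← abs_sq_sub_sq_eq, Real.rpow_ofNat, sq_abs, ← Real.sqrt_eq_rpow] at hcs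
  refine ⟨hcs.1, ?_⟩
  set S := ∑' e : (graph K j).Dart, (f e.fst - f e.snd) ^ 2 with hS
  set R := ∑' e : (graph K j).Dart, (f e.fst + f e.snd) ^ 2 with hR
  have hS0 : 0 ≤ S := tsum_nonneg fun _ => sq_nonneg _
  have hR0 : 0 ≤ R := tsum_nonneg fun _ => sq_nonneg _
  -- With h the mesh, the weighted `S` is 2h² times the Dirichlet form and the weighted `R` is at
  -- most 4‖f‖²; hence √8 · h.
  calc _ ≤ edgeWeight d j * (√S * √R) := by gcongr; exact hcs.2
    _ = √(edgeWeight d j * S * (edgeWeight d j * R)) := by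
        rw [← Real.sqrt_mul hS0, show edgeWeight d j * S * (edgeWeight d j * R) =
          edgeWeight d j ^ 2 * (S * R) by ring, Real.sqrt_mul (sq_nonneg _), Real.sqrt_sq hw.le]
    _ ≤ √(edgeWeight d j * S * (4 * ‖f‖ ^ 2)) := by gcongr
    _ = √(8 * mesh j ^ 2 * (dirichletForm K j f f * ‖f‖ ^ 2)) := by
        rw [dirichletForm_self_eq, ← hS]
        congr 1
        field_simp
        ring
    _ = _ := by
        rw [Real.sqrt_mul (by positivity), Real.sqrt_mul (by positivity), Real.sqrt_sq hh.le]

theorem boundaryWeight_eq_tsum (A : Set (State K j)) :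
    boundaryWeight K j A = ENNReal.ofReal (edgeWeight d j) *
      ∑' e : (graph K j).Dart, {e : (graph K j).Dart | e.fst ∈ A ∧ e.snd ∉ A}.indicator 1 e := by
  let _ : MeasurableSpace (graph K j).Dart := ⊤
  rw [boundaryWeight, ← Measure.count_apply
    (s := {e : (graph K j).Dart | e.fst ∈ A ∧ e.snd ∉ A}) trivial,
    ← lintegral_indicator_one (by trivial), lintegral_count]

/-- The coarea inequality. -/
theorem lintegral_boundaryWeight_le (F : State K j → ℝ) :
    ∫⁻ s in Ioi (0 : ℝ), boundaryWeight K j {x | s < F x} ≤ ENNReal.ofReal (edgeWeight d j) *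
      ∑' e : (graph K j).Dart, ENNReal.ofReal |F e.fst - F e.snd| := by
  -- A dart leaves {F > s} exactly for `s` in an interval whose length is the positive part of its
  -- drop in `F`.
  have h : ∀ (s : ℝ) (e : (graph K j).Dart),
      {e : (graph K j).Dart | e.fst ∈ {x | s < F x} ∧ e.snd ∉ {x | s < F x}}.indicator
        (1 : (graph K j).Dart → ℝ≥0∞) e = (Ico (F e.snd) (F e.fst)).indicator 1 s := by
    intro s e
    simp only [indicator_apply, mem_ofPred_eq, not_lt, mem_Ico, and_comm, Pi.one_apply]
  simp only [boundaryWeight_eq_tsum, h]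
  rw [lintegral_const_mul _ (Measurable.tsum fun e =>
    measurable_one.indicator measurableSet_Ico), lintegral_tsum fun e =>
    (measurable_one.indicator measurableSet_Ico).aemeasurable]
  gcongr with e
  rw [lintegral_indicator_one measurableSet_Ico]
  refine (Measure.restrict_apply_le _ _).trans ?_
  rw [Real.volume_Ico]
  exact ENNReal.ofReal_le_ofReal (le_abs_self _)

/-- Every lattice vertex has a neighbour, so its mass is at least the edge weight. This makes the
level sets admissible for isoperimetry. -/
theorem finite_of_speedMeasure_lt_top [NeZero d] {A : Set (State K j)}
    (hA : speedMeasure K j A < ∞) : A.Finite := by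
  have hw := edgeWeight_pos (d := d) j
  have h1 : ENNReal.ofReal (edgeWeight d j) * ((A \ {State.star}).encard : ℝ≥0∞) < ∞ := by
    refine lt_of_le_of_lt ?_ hA
    have h1 : ((A \ {State.star}).encard : ℝ≥0∞) =
        ∑' x, (A \ {State.star}).indicator (1 : State K j → ℝ≥0∞) x := by
      rw [← Measure.count_apply (s := A \ {State.star}) trivial,
        ← lintegral_indicator_one (s := A \ {State.star}) trivial, lintegral_count]
    rw [speedMeasure_apply, h1, ← ENNReal.tsum_mul_left]
    refine ENNReal.tsum_le_tsum fun x => ?_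
    by_cases hx : x ∈ A
    · rcases x with ⟨z, hz⟩ | _
      · rw [indicator_of_mem hx, indicator_of_mem (by exact ⟨hx, by simp⟩)]
        gcongr
        exact le_mul_of_one_le_right' (one_le_degree_pt z hz)
      · simp
    · simp [hx]
  have h2 : (A \ {State.star}).Finite := by
    rw [← encard_lt_top_iff, ← ENat.toENNReal_lt_top]
    exact ENNReal.lt_top_of_mul_ne_top_right h1.ne (by simpa using hw)
  exact (h2.union (finite_singleton _)).subset fun x hx => by
    by_cases h : x = .star
    · exact Or.inr h
    · exact Or.inl ⟨hx, h⟩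

/-- Square and rearrange: 128 = 4 · 4 · 8, where one 4 comes from (u/2)² and the other bounds
2^{2/d}, using d ≥ 1. -/
theorem nash_of_le_sqrt {dd u a E C : ℝ} (hd : 1 ≤ dd) (hu : 0 < u) (ha : 0 < a) (hE : 0 ≤ E)
    (hC : 0 < C) (h : u / 2 ≤ (2 * a ^ 2 / u) ^ (1 / dd) * (√8 / C * √(E * u))) :
    C ^ 2 / 128 * u ^ (1 + 2 / dd) ≤ E * a ^ (4 / dd) := by
  have h1 : (u / 2) ^ 2 ≤ ((2 * a ^ 2 / u) ^ (1 / dd) * (√8 / C * √(E * u))) ^ 2 := by gcongr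
  have h2 : ((2 * a ^ 2 / u) ^ (1 / dd)) ^ 2 = 2 ^ (2 / dd) * a ^ (4 / dd) / u ^ (2 / dd) := by
    rw [← Real.rpow_natCast, ← Real.rpow_mul (by positivity), Real.div_rpow (by positivity) hu.le,
      Real.mul_rpow (by positivity) (by positivity), ← Real.rpow_natCast a 2, ← Real.rpow_mul ha.le]
    push_cast
    rw [show 1 / dd * 2 = 2 / dd by ring, show 2 * (2 / dd) = 4 / dd by ring]
  have h3 : (2 : ℝ) ^ (2 / dd) ≤ 4 := by
    calc (2 : ℝ) ^ (2 / dd) ≤ 2 ^ (2 : ℝ) := by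
          refine Real.rpow_le_rpow_of_exponent_le (by norm_num) ?_
          rw [div_le_iff₀ (by linarith)]
          linarith
      _ = 4 := by norm_num
  rw [mul_pow, mul_pow, div_pow √8, Real.sq_sqrt (by norm_num), Real.sq_sqrt (by positivity), h2]
    at h1
  have h4 : 0 < u ^ (2 / dd) := by positivity
  have h5 : 0 < a ^ (4 / dd) := by positivity
  rw [Real.rpow_add hu, Real.rpow_one]
  have h6 : 2 ^ (2 / dd) * a ^ (4 / dd) / u ^ (2 / dd) * (8 / C ^ 2 * (E * u)) ≤
      4 * a ^ (4 / dd) / u ^ (2 / dd) * (8 / C ^ 2 * (E * u)) := by gcongr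
  have h7 := h1.trans h6
  have h8 : 4 * a ^ (4 / dd) / u ^ (2 / dd) * (8 / C ^ 2 * (E * u)) =
      (E * a ^ (4 / dd)) * (32 * u / (C ^ 2 * u ^ (2 / dd))) := by
    field_simp
    ring
  rw [h8, ← div_le_iff₀ (by positivity)] at h7
  refine le_trans (le_of_eq ?_) h7
  field_simp
  ring

theorem lintegral_ofReal_sq [NeZero d] (f : L2 K j) :
    ∫⁻ x, ENNReal.ofReal (f x ^ 2) ∂(speedMeasure K j) = ENNReal.ofReal (‖f‖ ^ 2) := by
  obtain ⟨h1, h2⟩ := tsum_dart_sq K j f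
  rw [lintegral_speedMeasure, ← ENNReal.ofReal_tsum_of_nonneg (fun _ => sq_nonneg _) h1,
    ← ENNReal.ofReal_mul (edgeWeight_pos (d := d) j).le, h2]

theorem measure_lt_sq_mul_le (f : State K j → ℝ) (s : ℝ) :
    ENNReal.ofReal √s * speedMeasure K j {x | s < f x ^ 2} ≤
      eLpNorm f 1 (speedMeasure K j) := by
  rw [eLpNorm_one_eq_lintegral_enorm]
  refine le_trans ?_ (mul_meas_ge_le_lintegral (measurable_of_countable _) (ENNReal.ofReal √s))
  refine mul_le_mul_right (measure_mono fun x (hx : s < f x ^ 2) => ?_) _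
  rw [mem_ofPred_eq, Real.enorm_eq_ofReal_abs]
  exact ENNReal.ofReal_le_ofReal ((Real.sqrt_le_sqrt hx.le).trans (Real.sqrt_sq_eq_abs _).le)

/-- The level sets of `f ^ 2` above height `T` have small total mass, by the isoperimetric
inequality and the coarea inequality. -/
theorem speedMeasure_level_le [NeZero d] {C : ℝ} (hC : 0 < C)
    (hiso : ∀ A : Set (State K j), A.Finite → A.Nonempty →
      ENNReal.ofReal (C * mesh j) * speedMeasure K j A ^ (((d : ℝ) - 1) / d) ≤
        boundaryWeight K j A)
    {f : State K j → ℝ} {a τ s : ℝ} (hτ : 0 < τ) (hs : τ ^ 2 ≤ s)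
    (ha : eLpNorm f 1 (speedMeasure K j) ≤ ENNReal.ofReal a) :
    speedMeasure K j {x | s < f x ^ 2} ≤
      ENNReal.ofReal (a / τ) ^ (1 / (d : ℝ)) * (ENNReal.ofReal (C * mesh j))⁻¹ *
        boundaryWeight K j {x | s < f x ^ 2} := by
  have hd1 : (1 : ℝ) ≤ d := by exact_mod_cast Nat.one_le_iff_ne_zero.2 (NeZero.ne d)
  have hh := mesh_pos j
  set A := {x : State K j | s < f x ^ 2} with hA
  rcases A.eq_empty_or_nonempty with h0 | hne
  · rw [h0]
    simp
  have hτs : τ ≤ √s := by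
    rw [← Real.sqrt_sq hτ.le]
    exact Real.sqrt_le_sqrt hs
  have hm : speedMeasure K j A ≤ ENNReal.ofReal (a / τ) := by
    rw [ENNReal.ofReal_div_of_pos hτ, ENNReal.le_div_iff_mul_le (by simp [hτ]) (by simp), mul_comm]
    calc _ ≤ ENNReal.ofReal √s * speedMeasure K j A := by gcongr
      _ ≤ _ := (measure_lt_sq_mul_le f s).trans ha
  have hfin := finite_of_speedMeasure_lt_top (hm.trans_lt ENNReal.ofReal_lt_top)
  have hb := hiso A hfin hne
  -- Markov's inequality bounds the first factor, isoperimetry the second.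
  have hsplit : speedMeasure K j A = speedMeasure K j A ^ (1 / (d : ℝ)) *
      speedMeasure K j A ^ (((d : ℝ) - 1) / d) := by
    rw [← ENNReal.rpow_add_of_nonneg _ _ (by positivity)
      (div_nonneg (by linarith) (by linarith)), ← add_div]
    rw [add_sub_cancel, div_self (by positivity), ENNReal.rpow_one]
  rw [hsplit, mul_assoc]
  gcongr
  rw [mul_comm (_)⁻¹, ← div_eq_mul_inv, ENNReal.le_div_iff_mul_le (by left; simp; positivity)
    (by simp), mul_comm]
  exact hb

theorem nash_of_isoperimetric [NeZero d] {C : ℝ} (hC : 0 < C)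
    (hiso : ∀ A : Set (State K j), A.Finite → A.Nonempty →
      ENNReal.ofReal (C * mesh j) * speedMeasure K j A ^ (((d : ℝ) - 1) / d) ≤
        boundaryWeight K j A)
    (f : L2 K j) (hf : MemLp f 1 (speedMeasure K j)) :
    C ^ 2 / 128 * ‖f‖ ^ (2 + 4 / (d : ℝ)) ≤
      dirichletForm K j f f * (eLpNorm f 1 (speedMeasure K j)).toReal ^ (4 / (d : ℝ)) := by
  have hd1 : (1 : ℝ) ≤ d := by exact_mod_cast Nat.one_le_iff_ne_zero.2 (NeZero.ne d)
  have hw := edgeWeight_pos (d := d) j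
  have hh := mesh_pos j
  have hE := dirichletForm_self_nonneg (K := K) (j := j) f
  rcases (norm_nonneg f).eq_or_lt with h0 | hpos
  · rw [← h0, Real.zero_rpow (by positivity), mul_zero]
    positivity
  set a := (eLpNorm f 1 (speedMeasure K j)).toReal with ha_def
  have ha : eLpNorm f 1 (speedMeasure K j) = ENNReal.ofReal a :=
    (ENNReal.ofReal_toReal hf.eLpNorm_ne_top).symm
  have ha0 : 0 < a := by
    refine ENNReal.toReal_pos (fun h => hpos.ne' ?_) hf.eLpNorm_ne_top
    rw [eLpNorm_eq_zero_iff (Lp.aestronglyMeasurable f) (by simp)] at h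
    rw [(Lp.eq_zero_iff_ae_eq_zero).2 h, norm_zero]
  set u := ‖f‖ ^ 2 with hu
  have hu0 : 0 < u := by positivity
  have hrpow : ‖f‖ ^ (2 + 4 / (d : ℝ)) = u ^ (1 + 2 / (d : ℝ)) := by
    rw [hu, ← Real.rpow_natCast, ← Real.rpow_mul (norm_nonneg _)]
    congr 1
    push_cast
    ring
  rw [hrpow]
  refine nash_of_le_sqrt hd1 hu0 ha0 hE hC ?_
  -- This height makes the low-level contribution at most τa = u/2, which is absorbed on the left.
  set τ := u / (2 * a) with hτ
  have hτ0 : 0 < τ := by positivity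
  let μ := speedMeasure K j
  let κ := ENNReal.ofReal (a / τ) ^ (1 / (d : ℝ)) * (ENNReal.ofReal (C * mesh j))⁻¹
  have hlow : ∫⁻ s in Ioi (0 : ℝ), μ {x | s < min (f x ^ 2) (τ ^ 2)} ≤
      ENNReal.ofReal (τ * a) := by
    rw [← lintegral_eq_lintegral_meas_lt μ (f := fun x => min (f x ^ 2) (τ ^ 2))
      (ae_of_all _ fun x => by simp only [Pi.zero_apply]; positivity)
      (measurable_of_countable _).aemeasurable,
      ENNReal.ofReal_mul hτ0.le, ← ha, eLpNorm_one_eq_lintegral_enorm,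
      ← lintegral_const_mul _ (measurable_of_countable _)]
    refine lintegral_mono fun x => ?_
    rw [Real.enorm_eq_ofReal_abs, ← ENNReal.ofReal_mul hτ0.le]
    refine ENNReal.ofReal_le_ofReal ?_
    rw [← sq_abs]
    rcases le_total |f x| τ with h | h
    · refine (min_le_left _ _).trans ?_
      rw [sq]
      gcongr
    · refine (min_le_right _ _).trans ?_
      rw [sq]
      gcongr
  have hcoarea : ∫⁻ s in Ioi (0 : ℝ), boundaryWeight K j {x | s < f x ^ 2} ≤
      ENNReal.ofReal (√8 * mesh j * √(dirichletForm K j f f * u)) := by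
    obtain ⟨h1, h2⟩ := tsum_dart_abs_sq_sub_sq_le f
    refine (lintegral_boundaryWeight_le fun x => f x ^ 2).trans ?_
    rw [← ENNReal.ofReal_tsum_of_nonneg (fun _ => abs_nonneg _) h1, ← ENNReal.ofReal_mul hw.le]
    exact ENNReal.ofReal_le_ofReal h2
  have hmain : ENNReal.ofReal u ≤ ENNReal.ofReal (τ * a) +
      κ * ENNReal.ofReal (√8 * mesh j * √(dirichletForm K j f f * u)) := by
    calc ENNReal.ofReal u = ∫⁻ s in Ioi (0 : ℝ), μ {x | s < f x ^ 2} := by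
          rw [← lintegral_ofReal_sq f]
          exact lintegral_eq_lintegral_meas_lt μ (ae_of_all _ fun x => sq_nonneg _)
            (measurable_of_countable _).aemeasurable
      _ ≤ ∫⁻ s in Ioi (0 : ℝ), (μ {x | s < min (f x ^ 2) (τ ^ 2)} +
            κ * boundaryWeight K j {x | s < f x ^ 2}) := by
          refine lintegral_mono fun s => ?_
          -- Below τ² truncation does not change the level set; from τ² on, isoperimetry applies to
          -- sets of mass at most a/τ.
          rcases lt_or_ge s (τ ^ 2) with hs | hs
          · refine le_trans (measure_mono fun x (hx : s < f x ^ 2) => ?_) le_self_add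
            exact lt_min hx hs
          · exact (speedMeasure_level_le hC hiso hτ0 hs ha.le).trans le_add_self
      _ = (∫⁻ s in Ioi (0 : ℝ), μ {x | s < min (f x ^ 2) (τ ^ 2)}) +
            κ * ∫⁻ s in Ioi (0 : ℝ), boundaryWeight K j {x | s < f x ^ 2} := by
          have hanti : Antitone fun s : ℝ => μ {x | s < min (f x ^ 2) (τ ^ 2)} :=
            fun s t hst => measure_mono fun x hx => lt_of_le_of_lt hst hx
          have hκ : κ ≠ ∞ := ENNReal.mul_ne_top
            (ENNReal.rpow_ne_top_of_nonneg (by positivity) ENNReal.ofReal_ne_top)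
            (ENNReal.inv_ne_top.2 (by simp; positivity))
          rw [lintegral_add_left hanti.measurable, lintegral_const_mul' _ _ hκ]
      _ ≤ _ := by gcongr
  have hκ : κ = ENNReal.ofReal ((a / τ) ^ (1 / (d : ℝ)) * (C * mesh j)⁻¹) := by
    rw [ENNReal.ofReal_mul (by positivity), ENNReal.ofReal_inv_of_pos (by positivity),
      ← ENNReal.ofReal_rpow_of_nonneg (by positivity) (by positivity)]
  rw [hκ, ← ENNReal.ofReal_mul (by positivity), ← ENNReal.ofReal_add (by positivity)
    (by positivity), ENNReal.ofReal_le_ofReal_iff (by positivity)] at hmain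
  have h1 : τ * a = u / 2 := by rw [hτ]; field_simp
  have h2 : a / τ = 2 * a ^ 2 / u := by rw [hτ]; field_simp
  have h3 : (C * mesh j)⁻¹ * (√8 * mesh j * √(dirichletForm K j f f * u)) =
      √8 / C * √(dirichletForm K j f f * u) := by field_simp
  rw [h1, h2, mul_assoc, h3] at hmain
  linarith

/-! ### Contraction of the semigroup on L¹ -/

theorem generator_inner [NeZero d] (f g : L2 K j) :
    ⟪generator K j f, g⟫ = -dirichletForm K j f g :=
  (existsUnique_generator K j).choose_spec.1 f g

theorem speedMeasure_singleton_ne_top (hb : Bornology.IsBounded K) (x : State K j) :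
    speedMeasure K j {x} ≠ ∞ := by
  rw [speedMeasure_singleton]
  refine ENNReal.mul_ne_top ENNReal.ofReal_ne_top ?_
  rcases x with ⟨z, hz⟩ | _
  · exact ne_top_of_le_ne_top (by finiteness) (degree_pt_le z hz)
  · obtain ⟨C, -, hC⟩ := degree_star_le hb
    exact ne_top_of_le_ne_top ENNReal.ofReal_ne_top (hC j)

/-- A vertex with a neighbour has positive mass, so almost-everywhere statements may be used inside
sums over darts. -/
theorem of_ae_of_adj [NeZero d] {p : State K j → Prop} (h : ∀ᵐ x ∂speedMeasure K j, p x)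
    {x y : State K j} (hxy : (graph K j).Adj x y) : p x := by
  have h1 : ({x | p x}.indicator 1 : State K j → ℝ) =ᵐ[speedMeasure K j] 1 := by
    filter_upwards [h] with x hx
    rw [indicator_of_mem (by exact hx)]
  have h2 := eq_of_ae_eq K j h1 hxy
  by_contra hp
  rw [indicator_of_notMem (by exact hp)] at h2
  simp at h2

/-- The `L¹` norm of `h` is at most `c` if the pairings of `h` with the functions in the unit ball
of `L^∞` are. -/
theorem eLpNorm_one_le_of_inner_le (hb : Bornology.IsBounded K) {h : L2 K j} {c : ℝ}
    (H : ∀ g : L2 K j, (∀ᵐ x ∂speedMeasure K j, |g x| ≤ 1) → ⟪h, g⟫ ≤ c) :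
    eLpNorm h 1 (speedMeasure K j) ≤ ENNReal.ofReal c := by
  rw [eLpNorm_one_eq_lintegral_enorm, lintegral_countable', ENNReal.tsum_eq_iSup_sum]
  refine iSup_le fun S => ?_
  have hS : MeasurableSet (S : Set (State K j)) := trivial
  have hfin : speedMeasure K j (S : Set (State K j)) ≠ ∞ := by
    rw [← sum_measure_singleton]
    exact ENNReal.sum_ne_top.2 fun x _ => speedMeasure_singleton_ne_top hb x
  rw [← lintegral_finset]
  have : IsFiniteMeasure ((speedMeasure K j).restrict (S : Set (State K j))) :=
    ⟨by rw [Measure.restrict_apply_univ]; exact hfin.lt_top⟩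
  have hsign : ∀ x, |(SignType.sign (h x) : ℝ)| ≤ 1 := fun x => by
    rcases lt_trichotomy (h x) 0 with h | h | h <;> simp [h]
  -- The test function is the sign of `h` cut off to a finite set of finite mass, so that it lies in
  -- L².
  have hmem : MemLp ((S : Set (State K j)).indicator fun x => (SignType.sign (h x) : ℝ)) 2
      (speedMeasure K j) :=
    (memLp_indicator_iff_restrict hS).2 (MemLp.of_bound
      (measurable_of_countable _).aestronglyMeasurable 1 (ae_of_all _ hsign))
  have hH := H hmem.toLp (by
    filter_upwards [hmem.coeFn_toLp] with x hx
    rw [hx]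
    by_cases hxS : x ∈ (S : Set (State K j))
    · rw [indicator_of_mem hxS]
      exact hsign x
    · rw [indicator_of_notMem hxS]
      simp)
  have hint : IntegrableOn h S (speedMeasure K j) :=
    integrableOn_Lp_of_measure_ne_top h fact_one_le_two_ennreal.elim hfin
  rw [← ofReal_integral_norm_eq_lintegral_enorm hint]
  refine ENNReal.ofReal_le_ofReal (le_trans (le_of_eq ?_) hH)
  rw [L2.inner_def, ← integral_indicator hS]
  refine integral_congr_ae ?_
  filter_upwards [hmem.coeFn_toLp] with x hx
  rw [hx]
  by_cases hxS : x ∈ (S : Set (State K j))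
  · rw [indicator_of_mem hxS, indicator_of_mem hxS, Real.norm_eq_abs]
    change _ = (SignType.sign (h x) : ℝ) * h x
    rw [sign_mul_self]
  · rw [indicator_of_notMem hxS, indicator_of_notMem hxS, inner_zero_right]

theorem inner_le_of_eLpNorm_one_le {h g : L2 K j} {c : ℝ} (hc : 0 ≤ c)
    (hh : eLpNorm h 1 (speedMeasure K j) ≤ ENNReal.ofReal c)
    (hg : ∀ᵐ x ∂speedMeasure K j, |g x| ≤ 1) : ⟪h, g⟫ ≤ c := by
  have hmem : Integrable h (speedMeasure K j) :=
    memLp_one_iff_integrable.1 ⟨Lp.aestronglyMeasurable h, hh.trans_lt ENNReal.ofReal_lt_top⟩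
  rw [eLpNorm_one_eq_lintegral_enorm, ← ofReal_integral_norm_eq_lintegral_enorm hmem,
    ENNReal.ofReal_le_ofReal_iff hc] at hh
  refine le_trans ?_ hh
  rw [L2.inner_def]
  refine integral_mono_ae (L2.integrable_inner h g) hmem.norm ?_
  filter_upwards [hg] with x hx
  calc ⟪h x, g x⟫ ≤ ‖h x‖ * ‖g x‖ := real_inner_le_norm _ _
    _ ≤ ‖h x‖ * 1 := by gcongr; exact hx
    _ = ‖h x‖ := mul_one _

theorem summable_mul_of_sq {ι : Type*} {F G : ι → ℝ} (hF : Summable fun i => F i ^ 2)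
    (hG : Summable fun i => G i ^ 2) : Summable fun i => F i * G i := by
  refine Summable.of_norm_bounded (hF.add hG) fun i => ?_
  rw [Real.norm_eq_abs, abs_le]
  constructor <;> nlinarith [sq_nonneg (F i - G i), sq_nonneg (F i + G i)]

theorem inner_eq_tsum_dart [NeZero d] (f g : L2 K j) :
    ⟪f, g⟫ = edgeWeight d j * ∑' e : (graph K j).Dart, f e.fst * g e.fst := by
  obtain ⟨hf, hf'⟩ := tsum_dart_sq K j f
  obtain ⟨hg, hg'⟩ := tsum_dart_sq K j g
  obtain ⟨-, hs'⟩ := tsum_dart_sq K j (f + g)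
  have hadd : ∀ e : (graph K j).Dart, (f + g : L2 K j) e.fst = f e.fst + g e.fst :=
    fun e => eq_of_ae_eq K j (Lp.coeFn_add f g) e.adj
  have hfg := summable_mul_of_sq hf hg
  have h1 : ∑' e : (graph K j).Dart, (f + g : L2 K j) e.fst ^ 2 =
      ∑' e : (graph K j).Dart, f e.fst ^ 2 + 2 * ∑' e : (graph K j).Dart, f e.fst * g e.fst +
        ∑' e : (graph K j).Dart, g e.fst ^ 2 := by
    rw [← tsum_mul_left, ← hf.tsum_add (hfg.mul_left 2),
      ← (hf.add (hfg.mul_left 2)).tsum_add hg]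
    refine tsum_congr fun e => ?_
    rw [hadd]
    ring
  rw [h1] at hs'
  have h2 := norm_add_sq_real f g
  linarith

/-- The averaging operator of the simple random walk on `G^j`, `1 + 2^{-2j} A`. -/
def averaging (K : Set (EuclideanSpace ℝ (Fin d))) (j : ℕ) [NeZero d] : L2 K j →L[ℝ] L2 K j :=
  1 + mesh j ^ 2 • generator K j

/-- Expanding the form and reversing darts leaves twice the diagonal sum minus twice the cross sum;
the identity in `averaging` cancels the diagonal. -/
theorem inner_averaging [NeZero d] (f g : L2 K j) :
    ⟪averaging K j f, g⟫ =
      edgeWeight d j * ∑' e : (graph K j).Dart, f e.fst * g e.snd := by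
  have hh := mesh_pos j
  let φ : (graph K j).Dart ≃ (graph K j).Dart :=
    Function.Involutive.toPerm _ SimpleGraph.Dart.symm_involutive
  have hf1 := (tsum_dart_sq K j f).1
  have hf2 := (tsum_dart_snd_sq f).1
  have hg1 := (tsum_dart_sq K j g).1
  have hg2 := (tsum_dart_snd_sq g).1
  have h11 := summable_mul_of_sq hf1 hg1
  have h12 := summable_mul_of_sq hf1 hg2
  have h21 := summable_mul_of_sq hf2 hg1
  have h22 := summable_mul_of_sq hf2 hg2
  have e22 : ∑' e : (graph K j).Dart, f e.snd * g e.snd =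
      ∑' e : (graph K j).Dart, f e.fst * g e.fst :=
    φ.tsum_eq fun e => f e.fst * g e.fst
  have e21 : ∑' e : (graph K j).Dart, f e.snd * g e.fst =
      ∑' e : (graph K j).Dart, f e.fst * g e.snd :=
    φ.tsum_eq fun e => f e.fst * g e.snd
  have hsum : ∑' e : (graph K j).Dart, (f e.fst - f e.snd) * (g e.fst - g e.snd) =
      2 * ∑' e : (graph K j).Dart, f e.fst * g e.fst -
        2 * ∑' e : (graph K j).Dart, f e.fst * g e.snd := by
    calc _ = ∑' e : (graph K j).Dart, ((f e.fst * g e.fst + f e.snd * g e.snd) -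
          (f e.fst * g e.snd + f e.snd * g e.fst)) := tsum_congr fun e => by ring
      _ = _ := by
        rw [(h11.add h22).tsum_sub (h12.add h21), h11.tsum_add h22, h12.tsum_add h21, e22, e21]
        ring
  rw [averaging, add_apply, smul_apply, inner_add_left, real_inner_smul_left, generator_inner,
    dirichletForm_eq, hsum, one_apply_eq_self, inner_eq_tsum_dart]
  field_simp
  ring

theorem eLpNorm_one_averaging_le [NeZero d] (hb : Bornology.IsBounded K) {f : L2 K j} {c : ℝ}
    (hc : 0 ≤ c) (hf : eLpNorm f 1 (speedMeasure K j) ≤ ENNReal.ofReal c) :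
    eLpNorm (averaging K j f) 1 (speedMeasure K j) ≤ ENNReal.ofReal c := by
  have hw := edgeWeight_pos (d := d) j
  refine eLpNorm_one_le_of_inner_le hb fun g hg => ?_
  simp only [eLpNorm_one_eq_lintegral_enorm, lintegral_speedMeasure, Real.enorm_eq_ofReal_abs] at hf
  have h1 : Summable fun e : (graph K j).Dart => |f e.fst| := by
    have h2 : ∑' e : (graph K j).Dart, ENNReal.ofReal |f e.fst| ≠ ∞ :=
      (ENNReal.lt_top_of_mul_ne_top_right (hf.trans_lt ENNReal.ofReal_lt_top).ne
        (by simpa using hw)).ne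
    simpa only [ENNReal.toReal_ofReal (abs_nonneg _)] using ENNReal.summable_toReal h2
  rw [← ENNReal.ofReal_tsum_of_nonneg (fun _ => abs_nonneg _) h1, ← ENNReal.ofReal_mul hw.le,
    ENNReal.ofReal_le_ofReal_iff hc] at hf
  rw [inner_averaging]
  refine le_trans (mul_le_mul_of_nonneg_left (Summable.tsum_le_tsum (fun e => ?_)
    (summable_mul_of_sq (tsum_dart_sq K j f).1 (tsum_dart_snd_sq g).1) h1) hw.le) hf
  calc f e.fst * g e.snd ≤ |f e.fst| * |g e.snd| := by
        rw [← abs_mul]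
        exact le_abs_self _
    _ ≤ |f e.fst| * 1 := by
        gcongr
        exact of_ae_of_adj hg e.adj.symm
    _ = _ := mul_one _

/-- Poissonization: the continuous-time walk is the discrete one run at a Poisson number of steps.
The series has nonnegative coefficients, so L¹ bounds on powers of `averaging` pass to the
semigroup. -/
theorem semigroup_eq [NeZero d] (t : ℝ) :
    semigroup K j t = Real.exp (-(t / mesh j ^ 2)) •
      NormedSpace.exp ((t / mesh j ^ 2) • averaging K j) := by
  have hh := mesh_pos j
  set s := t / mesh j ^ 2 with hs
  let _ : NormedAlgebra ℚ (L2 K j →L[ℝ] L2 K j) := NormedAlgebra.restrictScalars ℚ ℝ _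
  have h1 : t • generator K j = algebraMap ℝ (L2 K j →L[ℝ] L2 K j) (-s) + s • averaging K j := by
    rw [averaging, Algebra.algebraMap_eq_smul_one, smul_add, smul_smul, hs,
      div_mul_cancel₀ _ (by positivity)]
    module
  rw [semigroup, h1, NormedSpace.exp_add_of_commute (Algebra.commute_algebraMap_left _ _),
    ← NormedSpace.algebraMap_exp_comm, Algebra.algebraMap_eq_smul_one, smul_one_mul,
    Real.exp_eq_exp_ℝ]

/-- `P^j_t` is a contraction of `L¹`. -/
theorem eLpNorm_one_semigroup_le [NeZero d] (hb : Bornology.IsBounded K) {f : L2 K j} {c t : ℝ}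
    (hc : 0 ≤ c) (ht : 0 ≤ t) (hf : eLpNorm f 1 (speedMeasure K j) ≤ ENNReal.ofReal c) :
    eLpNorm (semigroup K j t f) 1 (speedMeasure K j) ≤ ENNReal.ofReal c := by
  have hh := mesh_pos j
  refine eLpNorm_one_le_of_inner_le hb fun g hg => ?_
  set s := t / mesh j ^ 2 with hs
  have hs0 : 0 ≤ s := by positivity
  have hpow : ∀ n : ℕ, eLpNorm ((averaging K j ^ n) f) 1 (speedMeasure K j) ≤
      ENNReal.ofReal c := by
    intro n
    induction n with
    | zero => simpa using hf
    | succ n ih =>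
      rw [pow_succ']
      exact eLpNorm_one_averaging_le hb hc ih
  have h1 := NormedSpace.exp_series_hasSum_exp' (𝕂 := ℝ) (s • averaging K j)
  let Φ : (L2 K j →L[ℝ] L2 K j) →L[ℝ] ℝ :=
    (innerSL ℝ g).comp (ContinuousLinearMap.apply ℝ (L2 K j) f)
  have hΦ : ∀ T, Φ T = ⟪T f, g⟫ := fun T => by
    change ⟪g, T f⟫ = _
    exact real_inner_comm _ _
  have h2 := h1.mapL Φ
  have h3 : HasSum (fun n : ℕ => (n.factorial : ℝ)⁻¹ • s ^ n) (Real.exp s) := by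
    rw [Real.exp_eq_exp_ℝ]
    exact NormedSpace.exp_series_hasSum_exp' (𝕂 := ℝ) s
  have h4 : ⟪NormedSpace.exp (s • averaging K j) f, g⟫ ≤ Real.exp s * c := by
    rw [← hΦ]
    -- Termwise, the pairing with `g` is at most `c` times the corresponding term of the series for
    -- exp s.
    refine hasSum_le (fun n => ?_) h2 (h3.mul_right c)
    rw [hΦ, smul_pow, smul_smul, smul_apply, real_inner_smul_left, smul_eq_mul]
    have := inner_le_of_eLpNorm_one_le hc (hpow n) hg
    gcongr
  rw [semigroup_eq, ← hs, smul_apply, real_inner_smul_left]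
  calc Real.exp (-s) * ⟪NormedSpace.exp (s • averaging K j) f, g⟫
      ≤ Real.exp (-s) * (Real.exp s * c) := by gcongr
    _ = c := by rw [← mul_assoc, ← Real.exp_add]; simp

/-! ### From the Nash inequality to the heat kernel bound -/

theorem isSelfAdjoint_generator [NeZero d] : IsSelfAdjoint (generator K j) := by
  rw [ContinuousLinearMap.isSelfAdjoint_iff_isSymmetric]
  intro f g
  change ⟪generator K j f, g⟫ = ⟪f, generator K j g⟫
  rw [real_inner_comm _ f, generator_inner, generator_inner, dirichletForm, dirichletForm]
  congr 2
  exact tsum_congr fun e => mul_comm _ _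

theorem semigroup_inner_left [NeZero d] (t : ℝ) (f g : L2 K j) :
    ⟪semigroup K j t f, g⟫ = ⟪f, semigroup K j t g⟫ := by
  have h : IsSelfAdjoint (semigroup K j t) :=
    ((IsSelfAdjoint.all t).smul isSelfAdjoint_generator).exp
  exact (ContinuousLinearMap.isSelfAdjoint_iff_isSymmetric.1 h) f g

theorem semigroup_add [NeZero d] (s t : ℝ) :
    semigroup K j (s + t) = semigroup K j s * semigroup K j t := by
  let _ : NormedAlgebra ℚ (L2 K j →L[ℝ] L2 K j) := NormedAlgebra.restrictScalars ℚ ℝ _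
  rw [semigroup, add_smul, NormedSpace.exp_add_of_commute
    (((Commute.refl (generator K j)).smul_left s).smul_right t)]
  rfl

/-- The generator is bounded, so P_{-t} inverts P_t. Positivity of the norm is needed to take
negative powers in the decay argument. -/
theorem semigroup_apply_ne_zero [NeZero d] (t : ℝ) {f : L2 K j} (hf : f ≠ 0) :
    semigroup K j t f ≠ 0 := by
  intro h
  have h1 : semigroup K j (-t + t) f = 0 := by
    rw [semigroup_add]
    change semigroup K j (-t) (semigroup K j t f) = 0
    rw [h, map_zero]
  rw [neg_add_cancel, semigroup, zero_smul, NormedSpace.exp_zero] at h1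
  exact hf h1

theorem hasDerivAt_norm_sq_semigroup [NeZero d] (f : L2 K j) (t : ℝ) :
    HasDerivAt (fun s => ‖semigroup K j s f‖ ^ 2)
      (-2 * dirichletForm K j (semigroup K j t f) (semigroup K j t f)) t := by
  have h1 : HasDerivAt (fun s : ℝ => semigroup K j s f)
      (generator K j (semigroup K j t f)) t :=
    ((ContinuousLinearMap.apply ℝ (L2 K j) f).hasFDerivAt.comp_hasDerivAt t
      (hasDerivAt_exp_smul_const' (generator K j) t))
  have h2 := h1.norm_sq
  rwa [real_inner_comm, generator_inner, mul_neg, ← neg_mul] at h2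

/-- Polynomial decay from the differential inequality `u' ≤ -2c u^{1+1/p}`. -/
theorem le_rpow_of_hasDerivAt {u u' : ℝ → ℝ} {c p : ℝ} (hc : 0 < c) (hp : 0 < p)
    (hu : ∀ t, 0 < u t) (hderiv : ∀ t, HasDerivAt u (u' t) t)
    (hle : ∀ t, 0 ≤ t → u' t ≤ -2 * c * u t ^ (1 + 1 / p)) {t : ℝ} (ht : 0 < t) :
    u t ≤ (2 * c * t / p) ^ (-p) := by
  have hv : ∀ s, HasDerivAt (fun s => u s ^ (-(1 / p)) - 2 * c / p * s)
      (u' s * (-(1 / p)) * u s ^ (-(1 / p) - 1) - 2 * c / p) s := fun s => by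
    have h1 := (hderiv s).rpow_const (p := -(1 / p)) (Or.inl (hu s).ne')
    have h2 := (hasDerivAt_id s).const_mul (2 * c / p)
    rw [mul_one] at h2
    exact h1.sub h2
  -- The differential inequality says that u^{-1/p} grows at rate at least 2c/p.
  have hmono : MonotoneOn (fun s => u s ^ (-(1 / p)) - 2 * c / p * s) (Ici 0) := by
    refine monotoneOn_of_hasDerivWithinAt_nonneg (convex_Ici 0)
      (fun s _ => (hv s).continuousAt.continuousWithinAt)
      (fun s _ => (hv s).hasDerivWithinAt) fun s hs => ?_
    rw [interior_Ici] at hs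
    have h1 := hle s (le_of_lt hs)
    have h2 : u s ^ (1 + 1 / p) * u s ^ (-(1 / p) - 1) = 1 := by
      rw [← Real.rpow_add (hu s)]
      convert Real.rpow_zero _ using 2
      ring
    have h3 : 0 < u s ^ (-(1 / p) - 1) := Real.rpow_pos_of_pos (hu s) _
    have h4 : u' s * u s ^ (-(1 / p) - 1) ≤ -2 * c := by
      calc _ ≤ -2 * c * u s ^ (1 + 1 / p) * u s ^ (-(1 / p) - 1) := by gcongr
        _ = _ := by rw [mul_assoc, h2, mul_one]
    have h5 : u' s * (-(1 / p)) * u s ^ (-(1 / p) - 1) - 2 * c / p =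
        (1 / p) * (-2 * c - u' s * u s ^ (-(1 / p) - 1)) := by ring
    rw [h5]
    exact mul_nonneg (by positivity) (by linarith)
  have h := hmono self_mem_Ici (mem_Ici.2 ht.le) ht.le
  have h0 : 0 < u 0 ^ (-(1 / p)) := Real.rpow_pos_of_pos (hu 0) _
  simp only [mul_zero, sub_zero] at h
  have h1 : 2 * c * t / p ≤ u t ^ (-(1 / p)) := by
    have : 2 * c * t / p = 2 * c / p * t := by ring
    linarith
  have h2 := Real.rpow_le_rpow_of_nonpos (z := -p) (by positivity) h1 (by linarith)
  rw [← Real.rpow_mul (hu t).le] at h2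
  have h3 : -(1 / p) * -p = 1 := by field_simp
  rwa [h3, Real.rpow_one] at h2

/-- Apply Nash to P_s f: its L¹ norm stays at most 1, so that factor drops out and the decay lemma
applies with p = d/2. -/
theorem norm_sq_semigroup_le [NeZero d] (hb : Bornology.IsBounded K) {c : ℝ} (hc : 0 < c)
    (hnash : ∀ f : L2 K j, MemLp f 1 (speedMeasure K j) →
      c * ‖f‖ ^ (2 + 4 / (d : ℝ)) ≤
        dirichletForm K j f f * (eLpNorm f 1 (speedMeasure K j)).toReal ^ (4 / (d : ℝ)))
    {f : L2 K j} (hf : eLpNorm f 1 (speedMeasure K j) ≤ 1) {t : ℝ} (ht : 0 < t) :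
    ‖semigroup K j t f‖ ^ 2 ≤ (2 * c * t / (d / 2)) ^ (-((d : ℝ) / 2)) := by
  have hd0 : (0 : ℝ) < d := by exact_mod_cast Nat.pos_of_ne_zero (NeZero.ne d)
  by_cases hf0 : f = 0
  · rw [hf0, map_zero, norm_zero, zero_pow two_ne_zero]
    positivity
  refine le_rpow_of_hasDerivAt (u := fun s => ‖semigroup K j s f‖ ^ 2) hc (by positivity)
    (fun s => ?_) (fun s => hasDerivAt_norm_sq_semigroup f s) (fun s hs => ?_) ht
  · have := norm_pos_iff.2 (semigroup_apply_ne_zero (K := K) (j := j) s hf0)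
    positivity
  · set g := semigroup K j s f with hg
    have h1 : eLpNorm g 1 (speedMeasure K j) ≤ ENNReal.ofReal 1 :=
      eLpNorm_one_semigroup_le hb zero_le_one hs (by simpa using hf)
    have h2 := hnash g ⟨Lp.aestronglyMeasurable g, h1.trans_lt ENNReal.ofReal_lt_top⟩
    have h3 : (eLpNorm g 1 (speedMeasure K j)).toReal ^ (4 / (d : ℝ)) ≤ 1 :=
      Real.rpow_le_one ENNReal.toReal_nonneg (ENNReal.toReal_le_of_le_ofReal zero_le_one h1)
        (by positivity)
    have h4 := mul_le_of_le_one_right (dirichletForm_self_nonneg (K := K) (j := j) g) h3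
    have h5 : (‖g‖ ^ 2) ^ (1 + 1 / ((d : ℝ) / 2)) = ‖g‖ ^ (2 + 4 / (d : ℝ)) := by
      rw [← Real.rpow_natCast, ← Real.rpow_mul (norm_nonneg _)]
      congr 1
      push_cast
      field_simp
      ring
    rw [h5]
    linarith

/-- Nash's argument: a Nash inequality gives the on-diagonal heat kernel bound. -/
theorem normOneInfty_semigroup_le [NeZero d] (hb : Bornology.IsBounded K) {c : ℝ} (hc : 0 < c)
    (hnash : ∀ f : L2 K j, MemLp f 1 (speedMeasure K j) →
      c * ‖f‖ ^ (2 + 4 / (d : ℝ)) ≤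
        dirichletForm K j f f * (eLpNorm f 1 (speedMeasure K j)).toReal ^ (4 / (d : ℝ)))
    {t : ℝ} (ht : 0 < t) :
    normOneInfty (semigroup K j t) ≤
      ENNReal.ofReal ((2 * c / d) ^ (-((d : ℝ) / 2)) / t ^ ((d : ℝ) / 2)) := by
  have hd0 : (0 : ℝ) < d := by exact_mod_cast Nat.pos_of_ne_zero (NeZero.ne d)
  set B := (2 * c / d) ^ (-((d : ℝ) / 2)) / t ^ ((d : ℝ) / 2) with hB
  have hB' : (2 * c * (t / 2) / (d / 2)) ^ (-((d : ℝ) / 2)) = B := by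
    rw [hB, div_eq_mul_inv (_ ^ _), ← Real.rpow_neg ht.le, ← Real.mul_rpow (by positivity) ht.le]
    congr 1
    field_simp
  have hB0 : 0 ≤ B := by positivity
  have hdecay : ∀ f : L2 K j, eLpNorm f 1 (speedMeasure K j) ≤ 1 →
      ‖semigroup K j (t / 2) f‖ ≤ √B := fun f hf =>
    Real.le_sqrt_of_sq_le (hB' ▸ norm_sq_semigroup_le hb hc hnash hf (half_pos ht))
  refine iSup₂_le fun f hf => ?_
  rw [eLpNorm_exponent_top]
  refine eLpNormEssSup_le_of_ae_bound (ae_iff_of_countable.2 fun x hx => ?_)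
  have hs : MeasurableSet ({x} : Set (State K j)) := trivial
  have hx' := speedMeasure_singleton_ne_top hb x
  set m := (speedMeasure K j).real {x} with hm
  have hm0 : 0 < m := ENNReal.toReal_pos hx hx'
  -- The normalized atom at `x` has L¹ norm 1, and pairing with it evaluates at `x`. The L² decay
  -- therefore applies to both halves of P_t = P_{t/2} P_{t/2}.
  let g : L2 K j := indicatorConstLp 2 hs hx' m⁻¹
  have hg : eLpNorm g 1 (speedMeasure K j) ≤ 1 := by
    rw [eLpNorm_congr_ae indicatorConstLp_coeFn, eLpNorm_indicator_const hs one_ne_zero (by simp)]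
    rw [ENNReal.toReal_one, div_one, ENNReal.rpow_one, Real.enorm_eq_ofReal (by positivity),
      ← ENNReal.ofReal_toReal hx', ← ENNReal.ofReal_mul (by positivity)]
    change ENNReal.ofReal (m⁻¹ * m) ≤ 1
    rw [inv_mul_cancel₀ hm0.ne', ENNReal.ofReal_one]
  have hval : ⟪g, semigroup K j t f⟫ = semigroup K j t f x := by
    rw [L2.inner_indicatorConstLp_eq_inner_setIntegral, Measure.restrict_singleton,
      integral_smul_measure, integral_dirac]
    change (m * semigroup K j t f x) * m⁻¹ = _
    field_simp
  have hsplit : semigroup K j t f = semigroup K j (t / 2) (semigroup K j (t / 2) f) := by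
    conv_lhs => rw [← add_halves t, semigroup_add]
    rfl
  rw [← hval, hsplit, ← semigroup_inner_left]
  calc ‖⟪semigroup K j (t / 2) g, semigroup K j (t / 2) f⟫‖
      ≤ ‖semigroup K j (t / 2) g‖ * ‖semigroup K j (t / 2) f‖ := norm_inner_le_norm _ _
    _ ≤ √B * √B := by gcongr; exacts [hdecay g hg, hdecay f hf]
    _ = B := Real.mul_self_sqrt hB0

end DarnedWalk

end

open DarnedWalk in
theorem mainTheorem5 (d : ℕ) [NeZero d] (K : Set (EuclideanSpace ℝ (Fin d)))
    (hK_compact : IsCompact K) (hK_connected : IsConnected K)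
    (hK_lipschitz : HasLipschitzBoundary K) :
    ∃ N₁ : ℕ, 1 ≤ N₁ ∧
      (∃ C₂ : ℝ, 0 < C₂ ∧ ∀ j : ℕ, N₁ ≤ j → ∀ A : Set (State K j), A.Finite → A.Nonempty →
        ENNReal.ofReal (C₂ * mesh j) * speedMeasure K j A ^ (((d : ℝ) - 1) / d) ≤
          boundaryWeight K j A) ∧
      (∃ c : ℝ, 0 < c ∧ ∀ j : ℕ, N₁ ≤ j → ∀ f : L2 K j, MemLp f 1 (speedMeasure K j) →
        c * ‖f‖ ^ (2 + 4 / (d : ℝ)) ≤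
          dirichletForm K j f f * (eLpNorm f 1 (speedMeasure K j)).toReal ^ (4 / (d : ℝ))) ∧
      ∃ C : ℝ, 0 < C ∧ ∀ j : ℕ, N₁ ≤ j → ∀ t : ℝ, 0 < t →
        normOneInfty (semigroup K j t) ≤ ENNReal.ofReal (C / t ^ ((d : ℝ) / 2)) := by
  have hd0 : (0 : ℝ) < d := by exact_mod_cast Nat.pos_of_ne_zero (NeZero.ne d)
  have hb := hK_compact.isBounded
  obtain ⟨N, hN, C, hC, hiso⟩ := isoperimetric hb
    (hK_lipschitz.interior_nonempty hK_compact hK_connected.nonempty)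
  have hnash := fun j (hj : N ≤ j) => nash_of_isoperimetric hC (hiso j hj)
  have hc : 0 < C ^ 2 / 128 := by positivity
  exact ⟨N, hN, ⟨C, hC, hiso⟩, ⟨_, hc, hnash⟩, _, by positivity,
    fun j hj t ht => normOneInfty_semigroup_le hb hc (hnash j hj) ht⟩
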